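/- Let $q>0$, $\sigma>0$, and let $f\in C([0,\infty)\times L^2(0,\pi);L^2(0,\pi))$ be an (unknown) nonlinearity with $f(t,0)=0$ and $\|f(t,v)-f(t,w)\|\le\sigma\|v-w\|$ for all $t\ge0$ and $v,w\in L^2(0,\pi)$, where $\|\cdot\|$ is the norm of $L^2(0,\pi)$. Consider the semilinear heat equation on $[0,\pi]$ with Neumann boundary input $u$ and boundary output $y$, $$z_t=z_{xx}+qz+f(t,z(\cdot,t)),\qquad z_x(0,t)=0,\quad z_x(\pi,t)=u(t),\qquad y(t)=z(0,t).$$ Let $\varphi_0=1/\sqrt\pi$ and $\varphi_n(x)=\sqrt{2/\pi}\cos nx$ for $n\ge1$. Fix $N\in\mathbb N$ with $N^2>q+\sigma$, and put $$A=\operatorname{diag}\{q-0^2,\,q-1^2,\ldots,q-(N-1)^2\},\quad B=[\varphi_0(\pi),\ldots,\varphi_{N-1}(\pi)]^\top,\quad C=[\varphi_0(0),\ldots,\varphi_{N-1}(0)],$$ $$\gamma=\frac1{\pi d^2}\Bigl[1-\pi d\cot\pi d+2\sum_{n=1}^{N-1}\frac{d^2}{d^2-n^2}\Bigr],\qquad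 d=\sqrt{q+\sigma},$$ where for integer $d$ (a removable singularity) the right-hand side is understood as its limit. Let $X,Z\in\mathbb R^{N\times N}$ be symmetric positive definite stabilizing solutions of the algebraic Riccati equations $$XA+A^\top X-X(BB^\top-\gamma\sigma I)X+\tfrac{\sigma}{\gamma}I=0,\qquad ZA^\top+AZ-Z(C^\top C-\gamma\sigma I)Z+\tfrac{\sigma}{\gamma}I=0,$$ where stabilizing means that all eigenvalues of $A-(BB^\top-\gamma\sigma I)X$ and of $A-Z(C^\top C-\gamma\sigma I)$, respectively, have negative real part. Assume that the spectral radius satisfies $\rho(XZ)<\gamma^{-2}$, set $K=B^\top X$ and $L=Z(I-\gamma^2XZ)^{-1}C^\top$, and apply the observer-based controller $$\dot{\hat z}^N(t)=(A+\gamma\sigma X)\hat z^N(t)+Bu(t)-L\bigl(C\hat z^N(t)-y(t)\bigr),\qquad \hat z^N(0)=0,\qquad u(t)=-K\hat z^N(t).$$ Then there is a constant $M\ge1$, independent of $f$ and of the initial state, such that every solution of the closed-loop system on $[0,\infty)$ satisfies $$\|z(\cdot,t)\|^2+|e^N(t)|^2\le M\|z(\cdot,0)\|^2,\qquad t\ge0,$$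 where $e^N=\hat z^N-z^N$, $z^N(t)=(\langle z(\cdot,t),\varphi_n\rangle)_{n=0}^{N-1}$, and $|\cdot|$ is the Euclidean norm. Here a solution is a weak (mild) one: $z\in C([0,\infty);L^2(0,\pi))$; for every $\varphi\in C^\infty([0,\pi])$ with $\varphi'(0)=\varphi'(\pi)=0$ and every $t>0$, $$\tfrac{d}{dt}\langle z(\cdot,t),\varphi\rangle=\langle z(\cdot,t),\varphi''+q\varphi\rangle+u(t)\varphi(\pi)+\langle f(t,z(\cdot,t)),\varphi\rangle;$$ for every $t>0$ the function $z(\cdot,t)$ has a representative continuous on $[0,\pi]$, whose value at $0$ is $y(t)$; and $\hat z^N$ is continuous on $[0,\infty)$ and satisfies the observer equation for all $t>0$. Classical solutions are solutions in this sense. -/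

import Mathlib

open MeasureTheory Set Filter Topology
open scoped Matrix ContDiff

noncomputable section

namespace HeatControl

/-! ### The state space, test functions and modes -/

/-- The Lebesgue space `L²(0,π)` of real functions. -/
abbrev L2 : Type := Lp ℝ 2 (volume.restrict (Ioo (0 : ℝ) Real.pi))

/-- `⟨v, φ⟩ = ∫₀^π v(x) φ(x) dx` for `v ∈ L²(0,π)` and a function `φ` on the line. -/
def pair (v : L2) (φ : ℝ → ℝ) : ℝ := ∫ x in Ioo (0 : ℝ) Real.pi, v x * φ x

/-- The normalized eigenfunctions `φ_n` of the Neumann Laplacian on `[0,π]`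
(with eigenvalues `n²`). -/
def eigenfun (n : ℕ) (x : ℝ) : ℝ :=
  if n = 0 then 1 / √Real.pi else √(2 / Real.pi) * Real.cos (n * x)

/-- The vector `v^N = (v_0, …, v_{N-1})` of the first `N` Fourier coefficients of `v`. -/
def modes (N : ℕ) (v : L2) : Fin N → ℝ := fun n => pair v (eigenfun n)

/-- `v` has a representative that is continuous on `[0,π]`, and the value of that
(unique) representative at the end point `x = 0` is `y`. -/
def HasValueAtZero (v : L2) (y : ℝ) : Prop :=
  ∃ w : ℝ → ℝ, ContinuousOn w (Icc 0 Real.pi) ∧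
    (v =ᵐ[volume.restrict (Ioo (0 : ℝ) Real.pi)] w) ∧ w 0 = y

/-! ### The matrices of the truncated system and the residue gain -/

/-- `A = diag(q - 0², q - 1², …, q - (N-1)²)`. -/
def matA (N : ℕ) (q : ℝ) : Matrix (Fin N) (Fin N) ℝ :=
  Matrix.diagonal fun n => q - ((n : ℕ) : ℝ) ^ 2

/-- The column `B = (b_0, …, b_{N-1})ᵀ` with `b_n = φ_n(π)`. -/
def matB (N : ℕ) : Matrix (Fin N) (Fin 1) ℝ := Matrix.of fun n _ => eigenfun n Real.pi

/-- The row `C = (c_0, …, c_{N-1})` with `c_n = φ_n(0)`. -/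
def matC (N : ℕ) : Matrix (Fin 1) (Fin N) ℝ := Matrix.of fun _ n => eigenfun n 0

/-- The cotangent expression
`(π d²)⁻¹ (1 - π d cot(π d) + 2 ∑_{n=1}^{N-1} d² / (d² - n²))`. -/
def cotGain (N : ℕ) (d : ℝ) : ℝ :=
  1 / (Real.pi * d ^ 2) *
    (1 - Real.pi * d * Real.cot (Real.pi * d)
      + 2 * ∑ n ∈ Finset.Ico 1 N, d ^ 2 / (d ^ 2 - (n : ℝ) ^ 2))

open Classical in
/-- The `L²` residue gain `γ`: the cotangent expression at `d = √(q + σ)`. Integers `d` are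
removable singularities of that expression, and there `γ` is its limit. -/
def residueGain (N : ℕ) (q σ : ℝ) : ℝ :=
  if ∃ m : ℕ, √(q + σ) = m then limUnder (𝓝[≠] √(q + σ)) (cotGain N)
  else cotGain N √(q + σ)

/-- All complex eigenvalues of the real square matrix `M` have negative real part. -/
def IsHurwitz {N : ℕ} (M : Matrix (Fin N) (Fin N) ℝ) : Prop :=
  ∀ μ ∈ spectrum ℂ (M.map (algebraMap ℝ ℂ)), μ.re < 0

/-- The spectral radius `ρ(M)`: the largest modulus of a complex eigenvalue of `M`. -/
def specRadius {N : ℕ} (M : Matrix (Fin N) (Fin N) ℝ) : ENNReal :=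
  spectralRadius ℂ (M.map (algebraMap ℝ ℂ))

/-- `X` is a stabilizing solution of
`XA + AᵀX - X(BBᵀ - γσI)X + (σ/γ)I = 0`: it solves the equation and
`A - (BBᵀ - γσI)X` is Hurwitz. -/
structure IsStabilizingControlARE (N : ℕ) (q σ γ : ℝ) (X : Matrix (Fin N) (Fin N) ℝ) :
    Prop where
  equation : X * matA N q + (matA N q)ᵀ * X
    - X * (matB N * (matB N)ᵀ - (γ * σ) • (1 : Matrix (Fin N) (Fin N) ℝ)) * X
    + (σ / γ) • (1 : Matrix (Fin N) (Fin N) ℝ) = 0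
  stabilizing : IsHurwitz
    (matA N q - (matB N * (matB N)ᵀ - (γ * σ) • (1 : Matrix (Fin N) (Fin N) ℝ)) * X)

/-- `Z` is a stabilizing solution of
`ZAᵀ + AZ - Z(CᵀC - γσI)Z + (σ/γ)I = 0`: it solves the equation and
`A - Z(CᵀC - γσI)` is Hurwitz. -/
structure IsStabilizingFilterARE (N : ℕ) (q σ γ : ℝ) (Z : Matrix (Fin N) (Fin N) ℝ) :
    Prop where
  equation : Z * (matA N q)ᵀ + matA N q * Z
    - Z * ((matC N)ᵀ * matC N - (γ * σ) • (1 : Matrix (Fin N) (Fin N) ℝ)) * Z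
    + (σ / γ) • (1 : Matrix (Fin N) (Fin N) ℝ) = 0
  stabilizing : IsHurwitz
    (matA N q - Z * ((matC N)ᵀ * matC N - (γ * σ) • (1 : Matrix (Fin N) (Fin N) ℝ)))

/-- The controller gain `K = BᵀX`. -/
def gainK (N : ℕ) (X : Matrix (Fin N) (Fin N) ℝ) : Matrix (Fin 1) (Fin N) ℝ :=
  (matB N)ᵀ * X

/-- The observer gain `L = Z(I - γ²XZ)⁻¹Cᵀ`. -/
def gainL (N : ℕ) (γ : ℝ) (X Z : Matrix (Fin N) (Fin N) ℝ) : Matrix (Fin N) (Fin 1) ℝ :=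
  Z * (1 - γ ^ 2 • (X * Z))⁻¹ * (matC N)ᵀ

/-! ### The closed-loop system -/

/-- The admissible nonlinearities: `f` is continuous from `[0,∞) × L²(0,π)` to `L²(0,π)`,
`f(t,0) = 0`, and `f(t,·)` is Lipschitz in the `L²` norm with constant `σ`. -/
structure IsAdmissible (σ : ℝ) (f : ℝ → L2 → L2) : Prop where
  continuousOn : ContinuousOn (Function.uncurry f) (Ici 0 ×ˢ univ)
  map_zero : ∀ t, 0 ≤ t → f t 0 = 0
  lipschitz : ∀ t, 0 ≤ t → ∀ v w : L2, ‖f t v - f t w‖ ≤ σ * ‖v - w‖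

/-- `z` is a weak (equivalently, mild) solution of
`z_t = z_xx + q z + f(t, z)`, `z_x(0,t) = 0`, `z_x(π,t) = u(t)` on `t ≥ 0`:
`z ∈ C([0,∞); L²(0,π))`, and for every smooth test function `φ` in the domain of the Neumann
Laplacian, `⟨z(t), φ⟩` satisfies for `t > 0` the equation obtained from the heat equation by
pairing it with `φ` and integrating by parts twice in space.
In particular every classical solution is a solution in this sense. -/
structure IsHeatSolution (q : ℝ) (f : ℝ → L2 → L2) (u : ℝ → ℝ) (z : ℝ → L2) : Prop where
  continuousOn : ContinuousOn z (Ici 0)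
  weak_eq : ∀ φ : ℝ → ℝ, ContDiff ℝ ∞ φ → deriv φ 0 = 0 → deriv φ Real.pi = 0 →
    ∀ t, 0 < t → HasDerivAt (fun s => pair (z s) φ)
      (pair (z t) (deriv (deriv φ)) + u t * φ Real.pi + q * pair (z t) φ
        + pair (f t (z t)) φ) t

/-- `(z, ẑ)` is a solution on `[0,∞)` of the closed loop formed by the heat equation with
Neumann input `u`, its output `y(t) = z(0,t)`, and the observer-based controller
`ẑ' = (A + γσX)ẑ + Bu - L(Cẑ - y)`, `u = -Kẑ`, `ẑ(0) = 0`. -/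
structure IsClosedLoopSolution (N : ℕ) (q σ γ : ℝ) (X : Matrix (Fin N) (Fin N) ℝ)
    (K : Matrix (Fin 1) (Fin N) ℝ) (L : Matrix (Fin N) (Fin 1) ℝ)
    (f : ℝ → L2 → L2) (z : ℝ → L2) (zhat : ℝ → Fin N → ℝ) (u y : ℝ → ℝ) : Prop where
  heat : IsHeatSolution q f u z
  output : ∀ t, 0 < t → HasValueAtZero (z t) (y t)
  zhat_continuousOn : ContinuousOn zhat (Ici 0)
  zhat_zero : zhat 0 = 0
  observer : ∀ t, 0 < t → HasDerivAt zhat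
    ((matA N q + (γ * σ) • X) *ᵥ zhat t + matB N *ᵥ ![u t]
      - L *ᵥ (matC N *ᵥ zhat t - ![y t])) t
  control : ∀ t, 0 ≤ t → u t = -(K *ᵥ zhat t) 0

end HeatControl

end

open HeatControl

namespace HeatControl

/-! ### Neumann eigenfunctions -/

/-! The proof is a small-gain argument with one quadratic energy, `energy`. For the low modes `x`
and the observer error `e` it uses the H∞ storage function `γ xᵀXx + γ⁻¹ eᵀ(Z⁻¹ - γ²X)e`; for the
modes `n ≥ N` it uses their squared `L²` norm.

The two Riccati equations make the storage grow at rate at most `-γu² - σ|x|² + σ⁻¹|w|² + γ⁻¹|y -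
Cx|²`, where `w` is the low part of `f` (`storage_dissipation`). The cotangent formula for `γ` is
the series `(2/π) ∑_{n ≥ N} (n² - d²)⁻¹` (`residueGain_eq_residueSeries`), so Cauchy–Schwarz bounds
both boundary traces of the high modes by `γ`. Hence their energy grows at rate at most `γu² +
σ⁻¹|f_high|² - σ|z_high|² - γ⁻¹(y - Cx)²` (`high_mode_dissipation`). On adding, the input and output
terms cancel, and `‖f‖ ≤ σ‖z‖` absorbs the nonlinearity, so the energy does not increase. It is
comparable with `‖z‖² + |e|²` because `ρ(XZ) < γ⁻²` makes `Z⁻¹ - γ²X` positive definite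
(`posDef_inv_sub_smul`).

For weak solutions this computation is carried out with finitely many high modes. The error vanishes
in the limit because the modes are absolutely summable, uniformly on compact intervals of positive
times (`exists_summable_mode_bound`); continuity of the energy then reaches time `0`. -/

theorem contDiff_eigenfun (n : ℕ) : ContDiff ℝ ∞ (eigenfun n) := by
  unfold eigenfun
  split_ifs
  · fun_prop
  · fun_prop

theorem continuous_eigenfun (n : ℕ) : Continuous (eigenfun n) :=
  (contDiff_eigenfun n).continuous

theorem hasDerivAt_eigenfun (n : ℕ) (x : ℝ) :
    HasDerivAt (eigenfun n) (-(n * √(2 / Real.pi) * Real.sin (n * x))) x := by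
  by_cases hn : n = 0
  · subst hn
    have h3 : eigenfun 0 = fun _ => 1 / √Real.pi := by
      funext y
      simp [eigenfun]
    rw [h3]
    simpa using hasDerivAt_const x (1 / √Real.pi)
  · have h1 : HasDerivAt (fun x : ℝ => (n : ℝ) * x) n x := by
      simpa using (hasDerivAt_id x).const_mul (n : ℝ)
    have h2 := h1.cos.const_mul √(2 / Real.pi)
    have h3 : eigenfun n = fun x : ℝ => √(2 / Real.pi) * Real.cos (n * x) := by
      funext y
      simp [eigenfun, hn]
    rw [h3]
    exact h2.congr_deriv (by ring)

theorem deriv_eigenfun (n : ℕ) :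
    deriv (eigenfun n) = fun x => -(n * √(2 / Real.pi) * Real.sin (n * x)) :=
  funext fun x => (hasDerivAt_eigenfun n x).deriv

theorem deriv_deriv_eigenfun (n : ℕ) :
    deriv (deriv (eigenfun n)) = fun x => -(n : ℝ) ^ 2 * eigenfun n x := by
  funext x
  rw [deriv_eigenfun]
  have h1 : HasDerivAt (fun x : ℝ => (n : ℝ) * x) n x := by
    simpa using (hasDerivAt_id x).const_mul (n : ℝ)
  have h2 := (h1.sin.const_mul (n * √(2 / Real.pi))).fun_neg
  rw [h2.deriv]
  by_cases hn : n = 0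
  · simp [hn]
  · simp only [eigenfun, hn, if_false]
    ring

theorem deriv_eigenfun_zero (n : ℕ) : deriv (eigenfun n) 0 = 0 := by
  simp [deriv_eigenfun]

theorem deriv_eigenfun_pi (n : ℕ) : deriv (eigenfun n) Real.pi = 0 := by
  simp [deriv_eigenfun, Real.sin_nat_mul_pi]

theorem sq_sqrt_two_div_pi : √(2 / Real.pi) ^ 2 = 2 / Real.pi :=
  Real.sq_sqrt (by positivity)

theorem eigenfun_zero_sq {n : ℕ} (hn : n ≠ 0) : eigenfun n 0 ^ 2 = 2 / Real.pi := by
  simp only [eigenfun, hn, if_false, mul_zero, Real.cos_zero, mul_one, sq_sqrt_two_div_pi]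

theorem eigenfun_pi_sq {n : ℕ} (hn : n ≠ 0) : eigenfun n Real.pi ^ 2 = 2 / Real.pi := by
  simp only [eigenfun, hn, if_false, mul_pow, sq_sqrt_two_div_pi, Real.cos_nat_mul_pi]
  rw [← pow_mul, mul_comm n 2, pow_mul]
  simp

theorem abs_eigenfun_le (n : ℕ) (x : ℝ) : |eigenfun n x| ≤ 1 := by
  have hpi : (2 : ℝ) ≤ Real.pi := Real.two_le_pi
  unfold eigenfun
  split_ifs
  · rw [abs_of_nonneg (by positivity), div_le_one (by positivity)]
    exact Real.one_le_sqrt.2 (by linarith)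
  · rw [abs_mul, abs_of_nonneg (Real.sqrt_nonneg _)]
    have h1 : √(2 / Real.pi) ≤ 1 := by
      refine Real.sqrt_le_one.2 ?_
      rwa [div_le_one (by positivity)]
    exact mul_le_one₀ h1 (abs_nonneg _) (Real.abs_cos_le_one _)

theorem integral_cos_int_mul (k : ℤ) :
    ∫ x in (0 : ℝ)..Real.pi, Real.cos (k * x) = if k = 0 then Real.pi else 0 := by
  split_ifs with hk
  · simp [hk]
  · have hk' : (k : ℝ) ≠ 0 := by exact_mod_cast hk
    rw [intervalIntegral.integral_comp_mul_left _ hk', integral_cos]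
    simp [Real.sin_int_mul_pi]

theorem integral_cos_mul_cos (n m : ℕ) :
    ∫ x in (0 : ℝ)..Real.pi, Real.cos (n * x) * Real.cos (m * x) =
      ((if (n : ℤ) - m = 0 then Real.pi else 0) + if (n : ℤ) + m = 0 then Real.pi else 0) / 2 := by
  rw [← integral_cos_int_mul, ← integral_cos_int_mul, ← intervalIntegral.integral_add
    (Continuous.intervalIntegrable (by fun_prop) _ _)
    (Continuous.intervalIntegrable (by fun_prop) _ _), ← intervalIntegral.integral_div]
  congr 1
  funext x
  push_cast
  rw [sub_mul, add_mul, Real.cos_sub, Real.cos_add]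
  ring

/-! ### The cosine basis of `L²(0,π)` -/

theorem memLp_of_continuous {φ : ℝ → ℝ} (hφ : Continuous φ) :
    MemLp φ 2 (volume.restrict (Ioo (0 : ℝ) Real.pi)) := by
  obtain ⟨c, hc⟩ := (isCompact_Icc (a := (0 : ℝ)) (b := Real.pi)).exists_bound_of_continuousOn
    hφ.continuousOn
  refine MemLp.of_bound hφ.aestronglyMeasurable c ?_
  filter_upwards [ae_restrict_mem measurableSet_Ioo] with x hx
  exact hc x (Ioo_subset_Icc_self hx)

theorem pair_eq_inner (v : L2) {φ : ℝ → ℝ} (hφ : Continuous φ) :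
    pair v φ = inner ℝ (memLp_of_continuous hφ).toLp v := by
  rw [L2.inner_def, pair]
  refine integral_congr_ae ?_
  filter_upwards [(memLp_of_continuous hφ).coeFn_toLp] with x hx
  simp [hx]

/-- The eigenfunctions as elements of `L²(0,π)`. -/
noncomputable def eigvec (n : ℕ) : L2 := (memLp_of_continuous (continuous_eigenfun n)).toLp

theorem coeFn_eigvec (n : ℕ) :
    eigvec n =ᵐ[volume.restrict (Ioo (0 : ℝ) Real.pi)] eigenfun n :=
  (memLp_of_continuous (continuous_eigenfun n)).coeFn_toLp

theorem pair_eigenfun (v : L2) (n : ℕ) : pair v (eigenfun n) = inner ℝ (eigvec n) v :=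
  pair_eq_inner v (continuous_eigenfun n)

theorem orthonormal_eigvec : Orthonormal ℝ eigvec := by
  rw [orthonormal_iff_ite]
  intro n m
  rw [← pair_eigenfun, pair]
  have h1 : ∫ x in Ioo (0 : ℝ) Real.pi, eigvec m x * eigenfun n x =
      ∫ x in (0 : ℝ)..Real.pi, eigenfun m x * eigenfun n x := by
    rw [intervalIntegral.integral_of_le Real.pi_pos.le, integral_Ioc_eq_integral_Ioo]
    refine integral_congr_ae ?_
    filter_upwards [coeFn_eigvec m] with x hx
    rw [hx]
  have hpi := Real.pi_pos
  have h2 : ∀ k : ℕ, ∀ x, eigenfun k x = (if k = 0 then 1 / √Real.pi else √(2 / Real.pi)) *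
      Real.cos (k * x) := by
    intro k x
    unfold eigenfun
    split_ifs with hk
    · simp [hk]
    · rfl
  have h3 : ∀ x, eigenfun m x * eigenfun n x =
      ((if m = 0 then 1 / √Real.pi else √(2 / Real.pi)) *
        (if n = 0 then 1 / √Real.pi else √(2 / Real.pi))) *
      (Real.cos (m * x) * Real.cos (n * x)) := by
    intro x
    rw [h2 m, h2 n]
    ring
  rw [h1]
  simp_rw [h3]
  rw [intervalIntegral.integral_const_mul, integral_cos_mul_cos]
  by_cases hmn : n = m
  · subst hmn
    by_cases hn : n = 0
    · have : √Real.pi ^ 2 = Real.pi := Real.sq_sqrt hpi.le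
      simp only [hn, if_true, Nat.cast_zero, sub_zero, add_zero]
      field_simp
      linarith
    · have h4 : (n : ℤ) + n ≠ 0 := by omega
      have := sq_sqrt_two_div_pi
      simp only [hn, if_false, h4, sub_self, if_true, add_zero]
      rw [← sq, this]
      field_simp
  · have h4 : (m : ℤ) - n ≠ 0 := by omega
    have h5 : (m : ℤ) + n ≠ 0 := by omega
    simp [h4, h5, hmn]

/-- Completeness of the cosines is reduced to that of Fourier series. The even reflection `v(x) +
v(-x)` on `(-π, π]` has Fourier coefficients proportional to the cosine integrals of `v`, so
Parseval forces it to vanish; on `(0, π)` it coincides with `v`. -/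
theorem ae_eq_zero_of_integral_cos_mul {v : ℝ → ℝ} (hv : MemLp v 2 volume)
    (hsupp : ∀ x, x ∉ Ioo (0 : ℝ) Real.pi → v x = 0)
    (h : ∀ n : ℕ, ∫ x, v x * Real.cos (n * x) = 0) :
    v =ᵐ[volume.restrict (Ioo (0 : ℝ) Real.pi)] 0 := by
  have hpi := Real.pi_pos
  have hab : -Real.pi < Real.pi := by linarith
  have hvint : Integrable v := by
    have h1 : IntegrableOn v (Ioo (0 : ℝ) Real.pi) :=
      (hv.restrict _).integrable (by norm_num)
    exact (integrableOn_iff_integrable_of_support_subset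
      (fun x hx => by_contra fun hx' => hx (hsupp x hx'))).1 h1
  let g : ℝ → ℂ := fun x => ((v x + v (-x) : ℝ) : ℂ)
  have hvneg : MemLp (fun x => v (-x)) 2 volume :=
    hv.comp_measurePreserving (Measure.measurePreserving_neg volume)
  have hg : MemLp g 2 (volume.restrict (Ioc (-Real.pi) Real.pi)) :=
    ((hv.add hvneg).ofReal).restrict _
  have hcoef : ∀ n : ℤ, fourierCoeffOn hab g n = 0 := by
    intro n
    rw [fourierCoeffOn_eq_integral]
    have hexp : ∀ x : ℝ, (fourier (-n) (x : AddCircle (Real.pi - -Real.pi)) : ℂ) =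
        Complex.exp (-(n * x : ℝ) * Complex.I) := by
      intro x
      rw [fourier_coe_apply]
      congr 1
      have : (Real.pi : ℂ) ≠ 0 := by exact_mod_cast hpi.ne'
      push_cast
      field_simp
      ring
    have hsum : ∫ x in (-Real.pi)..Real.pi,
        fourier (-n) (x : AddCircle (Real.pi - -Real.pi)) • g x =
        ∫ x, Complex.exp (-(n * x : ℝ) * Complex.I) * g x := by
      rw [intervalIntegral.integral_of_le hab.le]
      simp_rw [hexp, smul_eq_mul]
      refine setIntegral_eq_integral_of_forall_compl_eq_zero ?_
      intro x hx
      have h1 : v x = 0 := hsupp x (fun h' => hx ⟨by linarith [h'.1], h'.2.le⟩)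
      have h2 : v (-x) = 0 := by
        refine hsupp _ (fun h' => hx ⟨by linarith [h'.2], by linarith [h'.1]⟩)
      simp [g, h1, h2]
    have hi1 : Integrable (fun x => Complex.exp (-(n * x : ℝ) * Complex.I) * (v x : ℂ)) := by
      refine (hvint.ofReal (𝕜 := ℂ)).bdd_mul (c := 1)
        (Continuous.aestronglyMeasurable (by fun_prop)) (ae_of_all _ fun x => ?_)
      rw [← Complex.ofReal_neg, Complex.norm_exp_ofReal_mul_I]
    have hi3 : Integrable (fun x => Complex.exp ((n * x : ℝ) * Complex.I) * (v x : ℂ)) := by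
      refine (hvint.ofReal (𝕜 := ℂ)).bdd_mul (c := 1)
        (Continuous.aestronglyMeasurable (by fun_prop)) (ae_of_all _ fun x => ?_)
      rw [Complex.norm_exp_ofReal_mul_I]
    have hi2 : Integrable (fun x => Complex.exp (-(n * x : ℝ) * Complex.I) * (v (-x) : ℂ)) := by
      have := hi3.comp_neg
      simpa using this
    have hneg : ∫ x, Complex.exp (-(n * x : ℝ) * Complex.I) * (v (-x) : ℂ) =
        ∫ x, Complex.exp ((n * x : ℝ) * Complex.I) * (v x : ℂ) := by
      rw [← integral_neg_eq_self]
      simp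
    have hcos : ∫ x, Complex.exp (-(n * x : ℝ) * Complex.I) * g x =
        2 * ((∫ x, v x * Real.cos ((n.natAbs : ℕ) * x) : ℝ) : ℂ) := by
      have : ∀ x, Complex.exp (-(n * x : ℝ) * Complex.I) * g x =
          Complex.exp (-(n * x : ℝ) * Complex.I) * (v x : ℂ) +
          Complex.exp (-(n * x : ℝ) * Complex.I) * (v (-x) : ℂ) := by
        intro x
        simp only [g]
        push_cast
        ring
      simp_rw [this]
      rw [integral_add hi1 hi2, hneg, ← integral_add hi1 hi3, ← integral_complex_ofReal,
        ← integral_const_mul]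
      congr 1
      funext x
      have hc : Real.cos ((n.natAbs : ℕ) * x) = Real.cos (n * x) := by
        rcases Int.natAbs_eq n with h | h
        · conv_rhs => rw [h]
          simp
        · conv_rhs => rw [h]
          rw [Int.cast_neg, neg_mul, Real.cos_neg]
          simp
      rw [hc]
      push_cast
      rw [Complex.cos]
      ring_nf
    rw [hsum, hcos, h]
    simp
  have hsq := hasSum_sq_fourierCoeffOn hab hg
  simp only [hcoef, norm_zero, ne_eq, OfNat.ofNat_ne_zero, not_false_eq_true, zero_pow] at hsq
  have h0 := hsq.unique hasSum_zero
  have h1 : ∫ x in (-Real.pi)..Real.pi, ‖g x‖ ^ 2 = 0 := by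
    rcases smul_eq_zero.1 h0 with h | h
    · exact absurd h (inv_ne_zero (by linarith))
    · exact h
  rw [intervalIntegral.integral_of_le hab.le,
    integral_eq_zero_iff_of_nonneg (fun _ => by positivity) (hg.integrable_norm_pow (by norm_num))]
    at h1
  have h2 := ae_restrict_of_ae_restrict_of_subset
    (show Ioo (0 : ℝ) Real.pi ⊆ Ioc (-Real.pi) Real.pi from
      fun x hx => ⟨by linarith [hx.1], hx.2.le⟩) h1
  filter_upwards [h2, ae_restrict_mem measurableSet_Ioo] with x hx hx'
  have h3 : v (-x) = 0 := hsupp _ (fun h' => by linarith [h'.1, hx'.1])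
  simpa [g, h3] using hx

theorem eq_zero_of_pair_eigenfun {v : L2} (h : ∀ n, pair v (eigenfun n) = 0) : v = 0 := by
  have hpi := Real.pi_pos
  have hm : MemLp ((Ioo (0 : ℝ) Real.pi).indicator v) 2 volume :=
    (memLp_indicator_iff_restrict measurableSet_Ioo).2 (Lp.memLp v)
  have h1 := ae_eq_zero_of_integral_cos_mul hm (fun x hx => indicator_of_notMem hx _) ?_
  · rw [Lp.eq_zero_iff_ae_eq_zero]
    filter_upwards [h1, ae_restrict_mem measurableSet_Ioo] with x hx hx'
    rwa [indicator_of_mem hx'] at hx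
  · intro n
    have h2 : ∀ x, (Ioo (0 : ℝ) Real.pi).indicator v x * Real.cos (n * x) =
        (Ioo (0 : ℝ) Real.pi).indicator (fun x => v x * Real.cos (n * x)) x := by
      intro x
      by_cases hx : x ∈ Ioo (0 : ℝ) Real.pi <;> simp [hx]
    simp_rw [h2]
    rw [integral_indicator measurableSet_Ioo]
    have h3 := h n
    unfold pair eigenfun at h3
    split_ifs at h3 with hn
    · rw [integral_mul_const] at h3
      have : (1 / √Real.pi) ≠ 0 := by positivity
      simpa [hn] using (mul_eq_zero.1 h3).resolve_right this
    · simp_rw [mul_left_comm] at h3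
      rw [integral_const_mul] at h3
      have : √(2 / Real.pi) ≠ 0 := by positivity
      exact (mul_eq_zero.1 h3).resolve_left this

/-- The Hilbert basis of `L²(0,π)` formed by the Neumann eigenfunctions. -/
noncomputable def cosineBasis : HilbertBasis ℕ ℝ L2 :=
  HilbertBasis.mkOfOrthogonalEqBot orthonormal_eigvec <| by
    rw [Submodule.eq_bot_iff]
    intro v hv
    refine eq_zero_of_pair_eigenfun fun n => ?_
    rw [pair_eigenfun]
    exact Submodule.inner_right_of_mem_orthogonal (Submodule.subset_span (mem_range_self n)) hv

theorem coe_cosineBasis : ⇑cosineBasis = eigvec :=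
  HilbertBasis.coe_mkOfOrthogonalEqBot _ _

theorem hasSum_pair_smul_eigvec (v : L2) :
    HasSum (fun n => pair v (eigenfun n) • eigvec n) v := by
  have h := cosineBasis.hasSum_repr v
  simpa only [HilbertBasis.repr_apply_apply, coe_cosineBasis, ← pair_eigenfun] using h

/-- Parseval's identity. -/
theorem hasSum_pair_sq (v : L2) : HasSum (fun n => pair v (eigenfun n) ^ 2) (‖v‖ ^ 2) := by
  have h := cosineBasis.hasSum_inner_mul_inner v v
  simp only [coe_cosineBasis, real_inner_self_eq_norm_sq] at h
  refine h.congr_fun fun n => ?_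
  rw [pair_eigenfun, real_inner_comm (eigvec n) v, sq]

/-- A square integrable function whose cosine coefficients are summable and which has a
continuous representative is at `0` the sum of its cosine series. -/
theorem HasValueAtZero.hasSum {v : L2} {y : ℝ} (hy : HasValueAtZero v y)
    (hv : Summable fun n => |pair v (eigenfun n)|) :
    HasSum (fun n => eigenfun n 0 * pair v (eigenfun n)) y := by
  obtain ⟨w, hwc, hvw, rfl⟩ := hy
  let s : ℝ → ℝ := fun x => ∑' n, pair v (eigenfun n) * eigenfun n x
  have hbound : ∀ n x, ‖pair v (eigenfun n) * eigenfun n x‖ ≤ |pair v (eigenfun n)| := by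
    intro n x
    rw [norm_mul, Real.norm_eq_abs, Real.norm_eq_abs]
    exact mul_le_of_le_one_right (abs_nonneg _) (abs_eigenfun_le n x)
  have hsc : Continuous s :=
    continuous_tsum (fun n => continuous_const.mul (continuous_eigenfun n)) hv hbound
  have hss : ∀ x, HasSum (fun n => pair v (eigenfun n) * eigenfun n x) (s x) := fun x =>
    (Summable.of_norm_bounded hv (fun n => hbound n x)).hasSum
  have hcoe : ∀ m : ℕ, ⇑(∑ n ∈ Finset.range m, pair v (eigenfun n) • eigvec n)
      =ᵐ[volume.restrict (Ioo (0 : ℝ) Real.pi)]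
      fun x => ∑ n ∈ Finset.range m, pair v (eigenfun n) * eigenfun n x := by
    intro m
    have h1 : ∀ᵐ x ∂(volume.restrict (Ioo (0 : ℝ) Real.pi)), ∀ n,
        (pair v (eigenfun n) • eigvec n : L2) x = pair v (eigenfun n) * eigenfun n x := by
      rw [ae_all_iff]
      intro n
      filter_upwards [coeFn_eigvec n, Lp.coeFn_smul (pair v (eigenfun n)) (eigvec n)]
        with x hx hx'
      rw [hx', Pi.smul_apply, hx, smul_eq_mul]
    filter_upwards [h1, Lp.coeFn_finsetSum (Finset.range m)
      (fun n => pair v (eigenfun n) • eigvec n)] with x hx hx'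
    rw [hx']
    simp [hx]
  have hlim : Tendsto (fun m : ℕ => ∑ n ∈ Finset.range m, pair v (eigenfun n) • eigvec n)
      atTop (𝓝 v) := (hasSum_pair_smul_eigvec v).tendsto_sum_nat
  -- A subsequence of the partial sums converges a.e. to `v`, while the whole series converges
  -- uniformly to the continuous `s`. Thus `w = s` a.e., and continuity of both carries the equality
  -- to the end point `0`, itself a null set.
  have hmeas := tendstoInMeasure_of_tendsto_Lp hlim
  obtain ⟨ns, hns, hae⟩ := hmeas.exists_seq_tendsto_ae
  have hws : w =ᵐ[volume.restrict (Ioo (0 : ℝ) Real.pi)] s := by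
    filter_upwards [hvw, hae, ae_all_iff.2 hcoe] with x hx1 hx2 hx3
    simp_rw [hx3] at hx2
    rw [← hx1]
    exact tendsto_nhds_unique hx2 ((hss x).tendsto_sum_nat.comp hns.tendsto_atTop)
  rw [restrict_Ioo_eq_restrict_Icc] at hws
  have h0 := Measure.eqOn_Icc_of_ae_eq volume Real.pi_pos.ne hws hwc hsc.continuousOn
    (left_mem_Icc.2 Real.pi_pos.le)
  rw [h0]
  simpa only [mul_comm] using hss 0

/-! ### The residue gain as a series -/

theorem sq_sub_sq_pos {N n : ℕ} {s : ℝ} (hs : |s| < N) (hn : N ≤ n) : 0 < (n : ℝ) ^ 2 - s ^ 2 := by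
  have h1 : (N : ℝ) ≤ n := by exact_mod_cast hn
  have h2 : s ^ 2 < (N : ℝ) ^ 2 := sq_lt_sq.2 (by rwa [Nat.abs_cast])
  have h3 : (N : ℝ) ^ 2 ≤ (n : ℝ) ^ 2 := by gcongr
  linarith

/-- Comparison with `∑ n⁻²`: for `n ≥ N` one has `n² - r² ≥ (1 - r²/N²) n²`. -/
theorem summable_inv_sq_sub_sq (N : ℕ) {r : ℝ} (hr0 : 0 ≤ r) (hr : r < N) :
    Summable fun k : ℕ => (((k + N : ℕ) : ℝ) ^ 2 - r ^ 2)⁻¹ := by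
  have hN : 0 < (N : ℝ) := hr0.trans_lt hr
  have hpos : 0 < 1 - r ^ 2 / (N : ℝ) ^ 2 := by
    have := sq_sub_sq_pos (s := r) (by rwa [abs_of_nonneg hr0]) le_rfl
    rw [sub_pos, div_lt_one (by positivity)]
    linarith
  have h1 : Summable fun k : ℕ => (1 - r ^ 2 / (N : ℝ) ^ 2)⁻¹ * (((k + N : ℕ) : ℝ) ^ 2)⁻¹ :=
    ((summable_nat_add_iff N).2 (Real.summable_nat_pow_inv.2 one_lt_two)).mul_left _
  refine Summable.of_nonneg_of_le (fun k => ?_) (fun k => ?_) h1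
  · exact inv_nonneg.2 (sq_sub_sq_pos (by rwa [abs_of_nonneg hr0]) (Nat.le_add_left N k)).le
  · rw [← mul_inv]
    have hk : (N : ℝ) ≤ ((k + N : ℕ) : ℝ) := by exact_mod_cast Nat.le_add_left N k
    have hk0 : 0 < ((k + N : ℕ) : ℝ) := hN.trans_le hk
    refine inv_anti₀ (by positivity) ?_
    have : r ^ 2 ≤ r ^ 2 / (N : ℝ) ^ 2 * ((k + N : ℕ) : ℝ) ^ 2 := by
      rw [div_mul_eq_mul_div, le_div_iff₀ (by positivity)]
      gcongr
    linarith

/-- The series form `(2/π) ∑_{n ≥ N} (n² - s²)⁻¹` of the residue gain. -/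
noncomputable def residueSeries (N : ℕ) (s : ℝ) : ℝ :=
  ∑' k : ℕ, 2 / Real.pi * (((k + N : ℕ) : ℝ) ^ 2 - s ^ 2)⁻¹

theorem summable_residueSeries {N : ℕ} {s : ℝ} (hs : |s| < N) :
    Summable fun k : ℕ => 2 / Real.pi * (((k + N : ℕ) : ℝ) ^ 2 - s ^ 2)⁻¹ := by
  have h := summable_inv_sq_sub_sq N (abs_nonneg s) hs
  simp only [sq_abs] at h
  exact h.mul_left _

/-- Weierstrass M-test on `[-r, r]` with `|s| < r < N`, the terms at `r` being the majorants. This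
continuity identifies the limit defining the gain at integer `d`. -/
theorem continuousAt_residueSeries {N : ℕ} {s : ℝ} (hs : |s| < N) :
    ContinuousAt (residueSeries N) s := by
  obtain ⟨r, hsr, hrN⟩ := exists_between hs
  have hr0 : 0 ≤ r := (abs_nonneg s).trans hsr.le
  have hcont : ContinuousOn (residueSeries N) (Icc (-r) r) := by
    refine continuousOn_tsum (u := fun k => 2 / Real.pi * (((k + N : ℕ) : ℝ) ^ 2 - r ^ 2)⁻¹)
      (fun k => ?_) ((summable_inv_sq_sub_sq N hr0 hrN).mul_left _) (fun k x hx => ?_)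
    · refine ContinuousOn.mul continuousOn_const (ContinuousOn.inv₀ (by fun_prop) fun x hx => ?_)
      exact (sq_sub_sq_pos ((abs_le.2 hx).trans_lt hrN) (Nat.le_add_left N k)).ne'
    · have h1 := sq_sub_sq_pos ((abs_le.2 hx).trans_lt hrN) (Nat.le_add_left N k)
      have h2 := sq_sub_sq_pos (s := r) (by rwa [abs_of_nonneg hr0]) (Nat.le_add_left N k)
      rw [Real.norm_of_nonneg (by positivity)]
      have h3 : x ^ 2 ≤ r ^ 2 := sq_le_sq.2 (by rw [abs_of_nonneg hr0]; exact abs_le.2 hx)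
      gcongr
  exact hcont.continuousAt (Icc_mem_nhds (by linarith [neg_abs_le s]) (by linarith [le_abs_self s]))

/-- By the Mittag-Leffler expansion `π cot(πs) = 1/s - 2s ∑_{n ≥ 1} (n² - s²)⁻¹`, the finite sum in
`cotGain` cancels exactly the terms with `n < N`. -/
theorem cotGain_eq_residueSeries {N : ℕ} {s : ℝ} (hs : |s| < N) (hint : ∀ m : ℤ, s ≠ m) :
    cotGain N s = residueSeries N s := by
  have hpi := Real.pi_pos
  have hs0 : s ≠ 0 := by simpa using hint 0
  have hN : 1 ≤ N := by
    have : (0 : ℝ) < N := (abs_nonneg s).trans_lt hs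
    exact_mod_cast this
  have hz : (s : ℂ) ∈ Complex.integerComplement := by
    rintro ⟨m, hm⟩
    exact hint m (by exact_mod_cast hm.symm)
  have hne : ∀ n : ℕ, (n : ℝ) ^ 2 - s ^ 2 ≠ 0 := by
    intro n hn
    rcases sq_eq_sq_iff_eq_or_eq_neg.1 (sub_eq_zero.1 hn) with h | h
    · exact hint n (by rw [← h]; simp)
    · exact hint (-n) (by push_cast; linarith)
  have hcot := cot_series_rep' hz
  have hterm : ∀ n : ℕ, (1 / ((s : ℂ) - (n + 1)) + 1 / ((s : ℂ) + (n + 1))) =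
      ((-(2 * s) * (((n + 1 : ℕ) : ℝ) ^ 2 - s ^ 2)⁻¹ : ℝ) : ℂ) := by
    intro n
    have h1 : (s : ℂ) - (n + 1) ≠ 0 := by
      intro h
      exact hint (n + 1) (by have := sub_eq_zero.1 h; exact_mod_cast this)
    have h2 : (s : ℂ) + (n + 1) ≠ 0 := by
      intro h
      exact hint (-(n + 1)) (by have := eq_neg_of_add_eq_zero_left h; exact_mod_cast this)
    have h3 : ((n : ℂ) + 1) ^ 2 - (s : ℂ) ^ 2 ≠ 0 := by
      have := hne (n + 1)
      push_cast at this
      exact_mod_cast this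
    push_cast
    field_simp
    ring
  simp_rw [hterm] at hcot
  rw [← Complex.ofReal_tsum, tsum_mul_left] at hcot
  have hreal : Real.pi * Real.cot (Real.pi * s) - 1 / s =
      -(2 * s) * ∑' n : ℕ, (((n + 1 : ℕ) : ℝ) ^ 2 - s ^ 2)⁻¹ := by
    have : ((Real.pi * Real.cot (Real.pi * s) - 1 / s : ℝ) : ℂ) =
      ((-(2 * s) * ∑' n : ℕ, (((n + 1 : ℕ) : ℝ) ^ 2 - s ^ 2)⁻¹ : ℝ) : ℂ) := by
      rw [← hcot]
      push_cast
      rfl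
    exact_mod_cast this
  have hsumN : Summable fun k : ℕ => (((k + N : ℕ) : ℝ) ^ 2 - s ^ 2)⁻¹ := by
    have h := summable_inv_sq_sub_sq N (abs_nonneg s) hs
    simpa only [sq_abs] using h
  have hsum1 : Summable fun k : ℕ => (((k + 1 : ℕ) : ℝ) ^ 2 - s ^ 2)⁻¹ := by
    have h0 := (summable_nat_add_iff (f := fun k : ℕ => ((k : ℝ) ^ 2 - s ^ 2)⁻¹) N).1 hsumN
    exact (summable_nat_add_iff (f := fun k : ℕ => ((k : ℝ) ^ 2 - s ^ 2)⁻¹) 1).2 h0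
  have hsplit : ∑' n : ℕ, (((n + 1 : ℕ) : ℝ) ^ 2 - s ^ 2)⁻¹ =
      ∑ n ∈ Finset.Ico 1 N, ((n : ℝ) ^ 2 - s ^ 2)⁻¹ +
        ∑' k : ℕ, (((k + N : ℕ) : ℝ) ^ 2 - s ^ 2)⁻¹ := by
    rw [← hsum1.sum_add_tsum_nat_add (N - 1), Finset.sum_Ico_eq_sum_range]
    congr 1
    · refine Finset.sum_congr rfl fun k _ => ?_
      rw [add_comm]
    · refine tsum_congr fun k => ?_
      rw [show k + (N - 1) + 1 = k + N by omega]
  have hfin : ∑ n ∈ Finset.Ico 1 N, s ^ 2 / (s ^ 2 - (n : ℝ) ^ 2) =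
      -s ^ 2 * ∑ n ∈ Finset.Ico 1 N, ((n : ℝ) ^ 2 - s ^ 2)⁻¹ := by
    rw [Finset.mul_sum]
    refine Finset.sum_congr rfl fun n _ => ?_
    have h1 := hne n
    have h2 : s ^ 2 - (n : ℝ) ^ 2 ≠ 0 := by
      intro h
      exact h1 (by linarith)
    field_simp
    ring
  rw [residueSeries, tsum_mul_left, cotGain, hfin]
  rw [hsplit] at hreal
  set T := ∑' k : ℕ, (((k + N : ℕ) : ℝ) ^ 2 - s ^ 2)⁻¹
  set F := ∑ n ∈ Finset.Ico 1 N, ((n : ℝ) ^ 2 - s ^ 2)⁻¹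
  have h1 : Real.pi * s * Real.cot (Real.pi * s) = 1 - 2 * s ^ 2 * (F + T) := by
    have h2 : Real.pi * Real.cot (Real.pi * s) = 1 / s + -(2 * s) * (F + T) := by linarith
    calc Real.pi * s * Real.cot (Real.pi * s) = s * (Real.pi * Real.cot (Real.pi * s)) := by ring
      _ = 1 - 2 * s ^ 2 * (F + T) := by
        rw [h2]
        field_simp
        ring
  rw [h1]
  field_simp
  ring

theorem residueGain_eq_residueSeries {N : ℕ} {q σ : ℝ} (hN : √(q + σ) < N) :
    residueGain N q σ = residueSeries N √(q + σ) := by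
  have h0 := Real.sqrt_nonneg (q + σ)
  have habs : |√(q + σ)| < N := by rwa [abs_of_nonneg h0]
  unfold residueGain
  split_ifs with h
  · obtain ⟨m, hm⟩ := h
    refine Tendsto.limUnder_eq ?_
    have ht : Tendsto (residueSeries N) (𝓝[≠] √(q + σ)) (𝓝 (residueSeries N √(q + σ))) :=
      (continuousAt_residueSeries habs).tendsto.mono_left nhdsWithin_le_nhds
    refine ht.congr' ?_
    have h1 : ∀ᶠ s : ℝ in 𝓝[≠] √(q + σ), |s| < N :=
      nhdsWithin_le_nhds ((continuous_abs.tendsto _).eventually (gt_mem_nhds habs))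
    -- The only integer in this interval is `m`, which the punctured neighbourhood excludes, so the
    -- cotangent identity applies nearby.
    have h2 : ∀ᶠ s : ℝ in 𝓝[≠] √(q + σ), s ∈ Ioo ((m : ℝ) - 1) (m + 1) := by
      refine nhdsWithin_le_nhds (Ioo_mem_nhds ?_ ?_) <;> rw [hm] <;> linarith
    filter_upwards [h1, h2, self_mem_nhdsWithin] with s hs1 hs2 hs3
    refine (cotGain_eq_residueSeries hs1 fun k hk => hs3 ?_).symm
    have h4 : (m : ℤ) - 1 < k := by
      have := hs2.1
      rw [hk] at this
      exact_mod_cast this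
    have h5 : k < (m : ℤ) + 1 := by
      have := hs2.2
      rw [hk] at this
      exact_mod_cast this
    have h6 : k = m := by omega
    rw [mem_singleton_iff, hk, h6, hm]
    simp
  · refine cotGain_eq_residueSeries habs fun k hk => h ?_
    have hk0 : 0 ≤ k := by
      rw [hk] at h0
      exact_mod_cast h0
    refine ⟨k.toNat, hk.trans ?_⟩
    have : ((k.toNat : ℤ) : ℝ) = k := by rw [Int.toNat_of_nonneg hk0]
    rw [← this, Int.cast_natCast]

theorem residueSeries_pos {N : ℕ} {s : ℝ} (hs : |s| < N) : 0 < residueSeries N s := by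
  have hpi := Real.pi_pos
  have h := fun k => sq_sub_sq_pos hs (Nat.le_add_left N k)
  exact (summable_residueSeries hs).tsum_pos
    (fun k => mul_nonneg (by positivity) (inv_nonneg.2 (h k).le)) 0
    (mul_pos (by positivity) (inv_pos.2 (h 0)))

theorem sum_Ico_le_residueSeries {N : ℕ} {s : ℝ} (hs : |s| < N) (m : ℕ) :
    ∑ n ∈ Finset.Ico N m, 2 / Real.pi * ((n : ℝ) ^ 2 - s ^ 2)⁻¹ ≤ residueSeries N s := by
  have hpi := Real.pi_pos
  have h := fun k => sq_sub_sq_pos hs (Nat.le_add_left N k)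
  rw [Finset.sum_Ico_eq_sum_range]
  simp_rw [add_comm N]
  exact (summable_residueSeries hs).sum_le_tsum _
    (fun k _ => mul_nonneg (by positivity) (inv_nonneg.2 (h k).le))

/-- Sums of high modes weighted by coefficients of square `2/π`, such as the boundary values of the
eigenfunctions, are controlled by the residue series. -/
theorem sq_sum_mul_le_residueSeries {N : ℕ} {s : ℝ} (hs : |s| < N) (m : ℕ) (a z : ℕ → ℝ)
    (ha : ∀ n, N ≤ n → a n ^ 2 = 2 / Real.pi) :
    (∑ n ∈ Finset.Ico N m, a n * z n) ^ 2 ≤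
      residueSeries N s * ∑ n ∈ Finset.Ico N m, ((n : ℝ) ^ 2 - s ^ 2) * z n ^ 2 := by
  have hpos : ∀ n ∈ Finset.Ico N m, 0 < (n : ℝ) ^ 2 - s ^ 2 := fun n hn =>
    sq_sub_sq_pos hs (Finset.mem_Ico.1 hn).1
  -- Cauchy–Schwarz with weights `n² - s²`, positive because `|s| < N ≤ n`.
  have h1 := Finset.sum_sq_le_sum_mul_sum_of_sq_le_mul (Finset.Ico N m)
    (r := fun n => a n * z n) (f := fun n => 2 / Real.pi * ((n : ℝ) ^ 2 - s ^ 2)⁻¹)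
    (g := fun n => ((n : ℝ) ^ 2 - s ^ 2) * z n ^ 2)
    (fun n hn => mul_nonneg (by positivity) (inv_nonneg.2 (hpos n hn).le))
    (fun n hn => mul_nonneg (hpos n hn).le (sq_nonneg _))
    (fun n hn => by
      have := (hpos n hn).ne'
      rw [mul_pow, ha n (Finset.mem_Ico.1 hn).1]
      field_simp
      exact le_rfl)
  refine h1.trans (mul_le_mul_of_nonneg_right (sum_Ico_le_residueSeries hs m) ?_)
  exact Finset.sum_nonneg fun n hn => mul_nonneg (hpos n hn).le (sq_nonneg _)

/-! ### The finite-dimensional storage function -/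

section Matrices

variable {n k l : Type*} [Fintype n] [Fintype k] [Fintype l]

theorem dotProduct_mulVec_of_transpose_eq {X : Matrix n n ℝ} (hX : Xᵀ = X) (x y : n → ℝ) :
    x ⬝ᵥ X *ᵥ y = X *ᵥ x ⬝ᵥ y := by
  rw [Matrix.dotProduct_mulVec, ← Matrix.mulVec_transpose, hX]

theorem dotProduct_self_nonneg (x : n → ℝ) : 0 ≤ x ⬝ᵥ x :=
  Finset.sum_nonneg fun i _ => mul_self_nonneg (x i)

theorem hasDerivAt_quadForm {P : Matrix n n ℝ} (hP : Pᵀ = P) {x : ℝ → n → ℝ} {x' : n → ℝ} {t : ℝ}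
    (hx : HasDerivAt x x' t) :
    HasDerivAt (fun s => x s ⬝ᵥ P *ᵥ x s) (2 * (x t ⬝ᵥ P *ᵥ x')) t := by
  have h1 : ∀ i, HasDerivAt (fun s => x s i) (x' i) t := hasDerivAt_pi.1 hx
  have h2 : ∀ i, HasDerivAt (fun s => (P *ᵥ x s) i) ((P *ᵥ x') i) t := fun i =>
    HasDerivAt.fun_sum fun j _ => (h1 j).const_mul (P i j)
  have h3 : HasDerivAt (fun s => x s ⬝ᵥ P *ᵥ x s)
      (∑ i, (x' i * (P *ᵥ x t) i + x t i * (P *ᵥ x') i)) t :=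
    HasDerivAt.fun_sum fun i _ => (h1 i).mul (h2 i)
  refine h3.congr_deriv ?_
  rw [Finset.sum_add_distrib, two_mul]
  congr 1
  change x' ⬝ᵥ P *ᵥ x t = _
  rw [dotProduct_mulVec_of_transpose_eq hP, dotProduct_comm]

theorem continuous_quadForm (P : Matrix n n ℝ) : Continuous fun x : n → ℝ => x ⬝ᵥ P *ᵥ x :=
  Continuous.dotProduct continuous_id (Continuous.matrix_mulVec continuous_const continuous_id)

theorem exists_quadForm_le (P : Matrix n n ℝ) :
    ∃ c : ℝ, 0 ≤ c ∧ ∀ x : n → ℝ, x ⬝ᵥ P *ᵥ x ≤ c * (x ⬝ᵥ x) := by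
  refine ⟨∑ i, ∑ j, |P i j|, by positivity, fun x => ?_⟩
  have h1 : ∀ i j, x i * (P i j * x j) ≤ |P i j| * (x ⬝ᵥ x) := by
    intro i j
    have hi : x i ^ 2 ≤ x ⬝ᵥ x := by
      rw [sq]
      exact Finset.single_le_sum (f := fun i => x i * x i) (fun i _ => mul_self_nonneg _)
        (Finset.mem_univ i)
    have hj : x j ^ 2 ≤ x ⬝ᵥ x := by
      rw [sq]
      exact Finset.single_le_sum (f := fun i => x i * x i) (fun i _ => mul_self_nonneg _)
        (Finset.mem_univ j)
    have hij : |x i * x j| ≤ x ⬝ᵥ x := by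
      rw [abs_le]
      constructor <;> nlinarith [sq_nonneg (x i + x j), sq_nonneg (x i - x j)]
    calc x i * (P i j * x j) = P i j * (x i * x j) := by ring
      _ ≤ |P i j| * |x i * x j| := by rw [← abs_mul]; exact le_abs_self _
      _ ≤ |P i j| * (x ⬝ᵥ x) := by gcongr
  calc x ⬝ᵥ P *ᵥ x = ∑ i, ∑ j, x i * (P i j * x j) := by
        simp [dotProduct, Matrix.mulVec, Finset.mul_sum]
    _ ≤ ∑ i, ∑ j, |P i j| * (x ⬝ᵥ x) := by
        exact Finset.sum_le_sum fun i _ => Finset.sum_le_sum fun j _ => h1 i j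
    _ = (∑ i, ∑ j, |P i j|) * (x ⬝ᵥ x) := by
        simp only [Finset.sum_mul]

variable [DecidableEq n]

open scoped MatrixOrder in
-- Write `Z = DᴴD`. Then `Z⁻¹ - gX` is congruent to `1 - g D X Dᴴ`. An eigenvalue `ν ≤ 0` of the
-- latter, with eigenvector `v`, gives `XZ` the eigenvalue `(1 - ν)/g ≥ 1/g` with eigenvector `X Dᴴ
-- v`, contradicting the spectral radius bound.
theorem posDef_inv_sub_smul {X Z : Matrix n n ℝ} (hX : X.PosDef) (hZ : Z.PosDef) {g : ℝ}
    (hg : 0 < g)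
    (hρ : spectralRadius ℂ ((X * Z).map (algebraMap ℝ ℂ)) < ENNReal.ofReal g⁻¹) :
    (Z⁻¹ - g • X).PosDef := by
  obtain ⟨D, hD⟩ := CStarAlgebra.nonneg_iff_eq_star_mul_self.mp hZ.posSemidef.nonneg
  rw [Matrix.star_eq_conjTranspose] at hD
  have hDdet : IsUnit D.det := by
    have h := hZ.det_pos
    rw [hD, Matrix.det_mul] at h
    exact isUnit_iff_ne_zero.2 fun h0 => by simp [h0] at h
  have hDTdet : IsUnit Dᴴ.det := by
    rw [Matrix.det_conjTranspose]
    exact hDdet.star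
  have hHerm : (D * X * Dᴴ).IsHermitian := Matrix.isHermitian_mul_mul_conjTranspose D hX.isHermitian
  have hM : (1 - g • (D * X * Dᴴ)).IsHermitian := by
    unfold Matrix.IsHermitian
    rw [Matrix.conjTranspose_sub, Matrix.conjTranspose_smul, hHerm.eq]
    simp
  have hpos : (1 - g • (D * X * Dᴴ)).PosDef := by
    rw [hM.posDef_iff_eigenvalues_pos]
    intro i
    by_contra! hle
    set ν := hM.eigenvalues i
    set v : n → ℝ := (hM.eigenvectorBasis i).ofLp with hv
    have hv0 : v ≠ 0 := by
      intro h0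
      have h1 := hM.eigenvectorBasis.orthonormal.ne_zero i
      exact h1 (by ext j; exact congrFun h0 j)
    have hMv : (1 - g • (D * X * Dᴴ)) *ᵥ v = ν • v := hM.mulVec_eigenvectorBasis i
    set μ : ℝ := g⁻¹ * (1 - ν) with hμ
    have hHv : (D * X * Dᴴ) *ᵥ v = μ • v := by
      rw [Matrix.sub_mulVec, Matrix.one_mulVec, Matrix.smul_mulVec] at hMv
      have h1 : g • (D * X * Dᴴ) *ᵥ v = (1 - ν) • v := by
        rw [sub_smul, one_smul, ← hMv, sub_sub_cancel]
      rw [hμ, mul_smul, ← h1, smul_smul, inv_mul_cancel₀ hg.ne', one_smul]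
    have hinj1 : Function.Injective X.mulVec :=
      Matrix.mulVec_injective_of_isUnit hX.isUnit
    have hinj2 : Function.Injective Dᴴ.mulVec :=
      Matrix.mulVec_injective_of_isUnit ((Matrix.isUnit_iff_isUnit_det _).2 hDTdet)
    have hw0 : X *ᵥ (Dᴴ *ᵥ v) ≠ 0 := by
      intro h0
      have h1 := hinj1 (h0.trans (Matrix.mulVec_zero X).symm)
      exact hv0 (hinj2 (h1.trans (Matrix.mulVec_zero Dᴴ).symm))
    have hw : (X * Z) *ᵥ (X *ᵥ (Dᴴ *ᵥ v)) = μ • (X *ᵥ (Dᴴ *ᵥ v)) := by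
      rw [hD, ← Matrix.mulVec_smul, ← Matrix.mulVec_smul, ← hHv]
      simp only [Matrix.mulVec_mulVec, Matrix.mul_assoc]
    have hdet : (μ • (1 : Matrix n n ℝ) - X * Z).det = 0 := by
      refine Matrix.exists_mulVec_eq_zero_iff.1 ⟨_, hw0, ?_⟩
      rw [Matrix.sub_mulVec, hw, Matrix.smul_mulVec, Matrix.one_mulVec, sub_self]
    have hspec : (μ : ℂ) ∈ spectrum ℂ ((X * Z).map (algebraMap ℝ ℂ)) := by
      rw [spectrum.mem_iff, Matrix.isUnit_iff_isUnit_det]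
      have h1 : algebraMap ℂ (Matrix n n ℂ) μ - (X * Z).map (algebraMap ℝ ℂ) =
          (algebraMap ℝ ℂ).mapMatrix (μ • (1 : Matrix n n ℝ) - X * Z) := by
        ext a b
        by_cases hab : a = b <;> simp [Matrix.algebraMap_matrix_apply, hab]
      rw [h1, ← RingHom.map_det, hdet]
      simp
    have hle2 : (‖(μ : ℂ)‖₊ : ENNReal) ≤ spectralRadius ℂ ((X * Z).map (algebraMap ℝ ℂ)) :=
      le_iSup₂ (f := fun (k : ℂ) (_ : k ∈ spectrum ℂ ((X * Z).map (algebraMap ℝ ℂ))) =>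
        (‖k‖₊ : ENNReal)) (μ : ℂ) hspec
    have hμ1 : g⁻¹ ≤ μ := by
      have := inv_pos.2 hg
      rw [hμ]
      nlinarith
    have hlt := hle2.trans_lt hρ
    rw [← ENNReal.ofReal_coe_nnreal, ENNReal.ofReal_lt_ofReal_iff (inv_pos.2 hg), coe_nnnorm,
      Complex.norm_real, Real.norm_eq_abs] at hlt
    linarith [le_abs_self μ]
  have hE : Function.Injective ((D⁻¹)ᴴ).mulVec :=
    Matrix.mulVec_injective_of_isUnit ((Matrix.isUnit_iff_isUnit_det _).2 (by
      rw [Matrix.det_conjTranspose]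
      exact (Matrix.isUnit_nonsing_inv_det D hDdet).star))
  have h := hpos.conjTranspose_mul_mul_same hE
  convert h using 1
  rw [Matrix.conjTranspose_conjTranspose, hD, Matrix.mul_inv_rev, mul_sub, sub_mul, mul_one,
    ← Matrix.conjTranspose_nonsing_inv]
  congr 1
  have h1 : D⁻¹ * (D * X * Dᴴ) * (D⁻¹)ᴴ = X := by
    rw [Matrix.conjTranspose_nonsing_inv, Matrix.mul_assoc D X, Matrix.nonsing_inv_mul_cancel_left _ _ hDdet,
      Matrix.mul_nonsing_inv_cancel_right _ _ hDTdet]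
  rw [Matrix.mul_smul, Matrix.smul_mul, h1]

/-- The control Riccati equation as an identity between quadratic forms. -/
theorem riccati_control_form {A X : Matrix n n ℝ} {B : Matrix n k ℝ} {g h : ℝ} (hX : Xᵀ = X)
    (hare : X * A + Aᵀ * X - X * (B * Bᵀ - g • (1 : Matrix n n ℝ)) * X
      + h • (1 : Matrix n n ℝ) = 0) (x : n → ℝ) :
    2 * (X *ᵥ x ⬝ᵥ A *ᵥ x) = (Bᵀ *ᵥ (X *ᵥ x)) ⬝ᵥ (Bᵀ *ᵥ (X *ᵥ x))
      - g * (X *ᵥ x ⬝ᵥ X *ᵥ x) - h * (x ⬝ᵥ x) := by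
  have h1 := congrArg (fun M : Matrix n n ℝ => x ⬝ᵥ M *ᵥ x) hare
  simp only [mul_sub, sub_mul, Matrix.add_mulVec, Matrix.sub_mulVec, Matrix.smul_mulVec,
    ← Matrix.mulVec_mulVec, Matrix.mul_smul, Matrix.smul_mul, mul_one, Matrix.one_mulVec,
    Matrix.zero_mulVec, dotProduct_add, dotProduct_sub, dotProduct_smul, smul_eq_mul,
    dotProduct_zero] at h1
  have h2 : x ⬝ᵥ Aᵀ *ᵥ (X *ᵥ x) = X *ᵥ x ⬝ᵥ A *ᵥ x := by
    rw [Matrix.dotProduct_mulVec, ← Matrix.mulVec_transpose, Matrix.transpose_transpose,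
      dotProduct_comm]
  have h3 : X *ᵥ x ⬝ᵥ B *ᵥ (Bᵀ *ᵥ (X *ᵥ x)) = (Bᵀ *ᵥ (X *ᵥ x)) ⬝ᵥ (Bᵀ *ᵥ (X *ᵥ x)) := by
    rw [Matrix.dotProduct_mulVec, ← Matrix.mulVec_transpose]
  simp only [dotProduct_mulVec_of_transpose_eq hX x] at h1
  rw [h2, h3] at h1
  linarith

/-- The filter Riccati equation as an identity between quadratic forms in `Z⁻¹`. -/
theorem riccati_filter_form {A Z : Matrix n n ℝ} {C : Matrix l n ℝ} {g h : ℝ} (hZ : Z.PosDef)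
    (hare : Z * Aᵀ + A * Z - Z * (Cᵀ * C - g • (1 : Matrix n n ℝ)) * Z
      + h • (1 : Matrix n n ℝ) = 0) (x : n → ℝ) :
    2 * (Z⁻¹ *ᵥ x ⬝ᵥ A *ᵥ x) = (C *ᵥ x) ⬝ᵥ (C *ᵥ x)
      - g * (x ⬝ᵥ x) - h * (Z⁻¹ *ᵥ x ⬝ᵥ Z⁻¹ *ᵥ x) := by
  have hZT : Zᵀ = Z := by simpa using hZ.isHermitian.eq
  have hZx : Z *ᵥ (Z⁻¹ *ᵥ x) = x := by
    rw [Matrix.mulVec_mulVec, Matrix.mul_nonsing_inv _ hZ.det_pos.ne'.isUnit, Matrix.one_mulVec]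
  -- Duality: the filter equation is the control equation for the pair `(Aᵀ, Cᵀ)`, here evaluated at
  -- `Z⁻¹x`.
  have h0 : Z * Aᵀ + (Aᵀ)ᵀ * Z - Z * (Cᵀ * (Cᵀ)ᵀ - g • (1 : Matrix n n ℝ)) * Z
      + h • (1 : Matrix n n ℝ) = 0 := by
    simpa only [Matrix.transpose_transpose] using hare
  have h1 := riccati_control_form hZT h0 (Z⁻¹ *ᵥ x)
  rw [hZx, Matrix.transpose_transpose] at h1
  rw [← h1, Matrix.dotProduct_mulVec x, ← Matrix.mulVec_transpose, Matrix.transpose_transpose,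
    dotProduct_comm]

/-- Dissipation inequality for the state part of the storage function. -/
theorem state_dissipation {A X : Matrix n n ℝ} {B : Matrix n k ℝ} {g h : ℝ}
    (hX : Xᵀ = X)
    (hare : X * A + Aᵀ * X - X * (B * Bᵀ - g • (1 : Matrix n n ℝ)) * X
      + h • (1 : Matrix n n ℝ) = 0) (x w : n → ℝ) (u : k → ℝ) :
    2 * (x ⬝ᵥ X *ᵥ (A *ᵥ x + B *ᵥ u + w)) =
      (Bᵀ *ᵥ (X *ᵥ x) + u) ⬝ᵥ (Bᵀ *ᵥ (X *ᵥ x) + u) - u ⬝ᵥ u - h * (x ⬝ᵥ x)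
        - g * (X *ᵥ x ⬝ᵥ X *ᵥ x) + 2 * (X *ᵥ x ⬝ᵥ w) := by
  have h1 := riccati_control_form hX hare x
  have h2 : X *ᵥ x ⬝ᵥ B *ᵥ u = (Bᵀ *ᵥ (X *ᵥ x)) ⬝ᵥ u := by
    rw [Matrix.dotProduct_mulVec, ← Matrix.mulVec_transpose]
  rw [dotProduct_mulVec_of_transpose_eq hX]
  simp only [dotProduct_add, add_dotProduct, h2]
  rw [dotProduct_comm u (Bᵀ *ᵥ (X *ᵥ x))]
  linarith

/-- Dissipation inequality for the error part of the storage function. -/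
theorem error_dissipation {A X Z : Matrix n n ℝ} {B : Matrix n k ℝ} {C : Matrix l n ℝ}
    {L : Matrix n l ℝ} {γ σ : ℝ} (hγ : 0 < γ) (hσ : 0 < σ) (hX : Xᵀ = X) (hZ : Z.PosDef)
    (hXare : X * A + Aᵀ * X - X * (B * Bᵀ - (γ * σ) • (1 : Matrix n n ℝ)) * X
      + (σ / γ) • (1 : Matrix n n ℝ) = 0)
    (hZare : Z * Aᵀ + A * Z - Z * (Cᵀ * C - (γ * σ) • (1 : Matrix n n ℝ)) * Z
      + (σ / γ) • (1 : Matrix n n ℝ) = 0)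
    (hL : (Z⁻¹ - γ ^ 2 • X) * L = Cᵀ) (e r : n → ℝ) (ζ : l → ℝ) :
    2 * (e ⬝ᵥ (Z⁻¹ - γ ^ 2 • X) *ᵥ
        ((A + (γ * σ) • X) *ᵥ e - (γ * σ) • r - L *ᵥ (C *ᵥ e - ζ))) ≤
      -γ ^ 2 * ((Bᵀ *ᵥ (X *ᵥ e)) ⬝ᵥ (Bᵀ *ᵥ (X *ᵥ e))) + γ ^ 3 * σ * (r ⬝ᵥ r) + ζ ⬝ᵥ ζ := by
  have hZT : Zᵀ = Z := by simpa using hZ.isHermitian.eq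
  have hQ : (Z⁻¹ - γ ^ 2 • X)ᵀ = Z⁻¹ - γ ^ 2 • X := by
    rw [Matrix.transpose_sub, Matrix.transpose_smul, Matrix.transpose_nonsing_inv, hZT, hX]
  have h1 := riccati_control_form hX hXare e
  have h2 := riccati_filter_form hZ hZare e
  have h3 : e ⬝ᵥ (Z⁻¹ - γ ^ 2 • X) *ᵥ (L *ᵥ (C *ᵥ e - ζ)) = C *ᵥ e ⬝ᵥ (C *ᵥ e - ζ) := by
    rw [Matrix.mulVec_mulVec, hL, Matrix.dotProduct_mulVec, ← Matrix.mulVec_transpose,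
      Matrix.transpose_transpose]
  rw [Matrix.mulVec_sub, dotProduct_sub, h3, dotProduct_mulVec_of_transpose_eq hQ]
  have h4 : (Z⁻¹ - γ ^ 2 • X) *ᵥ e = Z⁻¹ *ᵥ e - γ ^ 2 • (X *ᵥ e) := by
    rw [Matrix.sub_mulVec, Matrix.smul_mulVec]
  rw [h4, Matrix.add_mulVec, Matrix.smul_mulVec]
  set a := Z⁻¹ *ᵥ e
  set p := X *ᵥ e
  set c := C *ᵥ e
  -- The gap in the inequality is exactly `|c - ζ|² + (σ/γ)|a - γ²p + γ²r|²`; the `e ⬝ᵥ e` terms of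
  -- the two Riccati identities cancel.
  have h5 : 0 ≤ (c - ζ) ⬝ᵥ (c - ζ) := dotProduct_self_nonneg _
  have h6 : 0 ≤ (a - γ ^ 2 • p + γ ^ 2 • r) ⬝ᵥ (a - γ ^ 2 • p + γ ^ 2 • r) :=
    dotProduct_self_nonneg _
  have h7 := mul_nonneg (div_nonneg hσ.le hγ.le) h6
  simp only [dotProduct_add, add_dotProduct, dotProduct_sub, sub_dotProduct, dotProduct_smul,
    smul_dotProduct, smul_eq_mul] at h5 h7 ⊢
  rw [dotProduct_comm ζ c] at h5
  rw [dotProduct_comm p a, dotProduct_comm r a, dotProduct_comm r p] at h7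
  have h8 : σ / γ * (a ⬝ᵥ a - γ ^ 2 * (a ⬝ᵥ p) - γ ^ 2 * (a ⬝ᵥ p - γ ^ 2 * (p ⬝ᵥ p)) +
      γ ^ 2 * (a ⬝ᵥ r - γ ^ 2 * (p ⬝ᵥ r)) +
      γ ^ 2 * (a ⬝ᵥ r - γ ^ 2 * (p ⬝ᵥ r) + γ ^ 2 * (r ⬝ᵥ r))) =
      σ / γ * (a ⬝ᵥ a) - 2 * γ * σ * (a ⬝ᵥ p) + γ ^ 3 * σ * (p ⬝ᵥ p) +
      2 * γ * σ * (a ⬝ᵥ r) - 2 * γ ^ 3 * σ * (p ⬝ᵥ r) + γ ^ 3 * σ * (r ⬝ᵥ r) := by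
    field_simp
    ring
  have h9 : γ ^ 2 * (2 * (p ⬝ᵥ A *ᵥ e)) = γ ^ 2 * (Bᵀ *ᵥ p ⬝ᵥ Bᵀ *ᵥ p)
      - γ ^ 3 * σ * (p ⬝ᵥ p) - γ * σ * (e ⬝ᵥ e) := by
    rw [h1]
    field_simp
  have h10 : 0 ≤ σ / γ * (a ⬝ᵥ a) - 2 * γ * σ * (a ⬝ᵥ p) + γ ^ 3 * σ * (p ⬝ᵥ p) +
      2 * γ * σ * (a ⬝ᵥ r) - 2 * γ ^ 3 * σ * (p ⬝ᵥ r) + γ ^ 3 * σ * (r ⬝ᵥ r) := by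
    rw [← h8]
    linarith
  linarith

/-- Dissipation inequality for the storage function `γ xᵀXx + γ⁻¹ eᵀ(Z⁻¹ - γ²X)e` of the truncated
closed loop with disturbances `w` in the state and `y - Cx` in the output. -/
theorem storage_dissipation {A X Z : Matrix n n ℝ} {B : Matrix n k ℝ} {C : Matrix l n ℝ}
    {L : Matrix n l ℝ} {γ σ : ℝ} (hγ : 0 < γ) (hσ : 0 < σ) (hX : Xᵀ = X) (hZ : Z.PosDef)
    (hXare : X * A + Aᵀ * X - X * (B * Bᵀ - (γ * σ) • (1 : Matrix n n ℝ)) * X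
      + (σ / γ) • (1 : Matrix n n ℝ) = 0)
    (hZare : Z * Aᵀ + A * Z - Z * (Cᵀ * C - (γ * σ) • (1 : Matrix n n ℝ)) * Z
      + (σ / γ) • (1 : Matrix n n ℝ) = 0)
    (hL : (Z⁻¹ - γ ^ 2 • X) * L = Cᵀ) (x xhat w : n → ℝ) (u : k → ℝ) (y : l → ℝ)
    (hu : u = -((Bᵀ * X) *ᵥ xhat)) :
    γ * (2 * (x ⬝ᵥ X *ᵥ (A *ᵥ x + B *ᵥ u + w))) +
      γ⁻¹ * (2 * ((xhat - x) ⬝ᵥ (Z⁻¹ - γ ^ 2 • X) *ᵥ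
        ((A + (γ * σ) • X) *ᵥ xhat + B *ᵥ u - L *ᵥ (C *ᵥ xhat - y)
          - (A *ᵥ x + B *ᵥ u + w)))) ≤
      -γ * (u ⬝ᵥ u) - σ * (x ⬝ᵥ x) + σ⁻¹ * (w ⬝ᵥ w) + γ⁻¹ * ((y - C *ᵥ x) ⬝ᵥ (y - C *ᵥ x)) := by
  have h1 := state_dissipation hX hXare x w u
  -- The observer's extra term `γσX` presumes the worst disturbance `w = γσXx`. The vector `r` is
  -- the scaled deviation from it, and completing the square in the state inequality yields a
  -- negative multiple of `|r|²` that cancels the one here.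
  have h2 := error_dissipation hγ hσ hX hZ hXare hZare hL (xhat - x)
    ((γ * σ)⁻¹ • w - X *ᵥ x) (y - C *ᵥ x)
  have hvec : (A + (γ * σ) • X) *ᵥ (xhat - x) - (γ * σ) • ((γ * σ)⁻¹ • w - X *ᵥ x)
      - L *ᵥ (C *ᵥ (xhat - x) - (y - C *ᵥ x)) =
      (A + (γ * σ) • X) *ᵥ xhat + B *ᵥ u - L *ᵥ (C *ᵥ xhat - y)
          - (A *ᵥ x + B *ᵥ u + w) := by
    have h3 : C *ᵥ (xhat - x) - (y - C *ᵥ x) = C *ᵥ xhat - y := by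
      rw [Matrix.mulVec_sub]
      abel
    rw [h3, smul_sub, smul_smul, mul_inv_cancel₀ (by positivity), one_smul, Matrix.mulVec_sub,
      Matrix.add_mulVec _ _ x, Matrix.smul_mulVec]
    abel
  -- The deviation from the ideal feedback `-BᵀXx` depends on the error alone, so its positive
  -- square is cancelled by the `-γ²` term of the error inequality.
  have hK : Bᵀ *ᵥ (X *ᵥ x) + u = -(Bᵀ *ᵥ (X *ᵥ (xhat - x))) := by
    rw [hu, ← Matrix.mulVec_mulVec, Matrix.mulVec_sub, Matrix.mulVec_sub]
    abel
  rw [hvec] at h2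
  rw [h1, hK, neg_dotProduct_neg]
  have h4 := mul_le_mul_of_nonneg_left h2 (inv_pos.2 hγ).le
  set E := (Bᵀ *ᵥ (X *ᵥ (xhat - x))) ⬝ᵥ (Bᵀ *ᵥ (X *ᵥ (xhat - x)))
  set F := (y - C *ᵥ x) ⬝ᵥ (y - C *ᵥ x)
  set G := 2 * ((xhat - x) ⬝ᵥ (Z⁻¹ - γ ^ 2 • X) *ᵥ
        ((A + (γ * σ) • X) *ᵥ xhat + B *ᵥ u - L *ᵥ (C *ᵥ xhat - y)
          - (A *ᵥ x + B *ᵥ u + w)))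
  simp only [dotProduct_sub, sub_dotProduct, dotProduct_smul, smul_dotProduct, smul_eq_mul] at h4
  rw [dotProduct_comm w (X *ᵥ x)] at h4
  have h5 : γ⁻¹ * (-γ ^ 2 * E + γ ^ 3 * σ * ((γ * σ)⁻¹ * ((γ * σ)⁻¹ * (w ⬝ᵥ w)
      - X *ᵥ x ⬝ᵥ w) - ((γ * σ)⁻¹ * (X *ᵥ x ⬝ᵥ w) - X *ᵥ x ⬝ᵥ X *ᵥ x)) + F) =
      -γ * E + σ⁻¹ * (w ⬝ᵥ w) - 2 * γ * (X *ᵥ x ⬝ᵥ w) + γ ^ 2 * σ * (X *ᵥ x ⬝ᵥ X *ᵥ x)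
        + γ⁻¹ * F := by
    field_simp
    ring
  have h6 : γ * (E - u ⬝ᵥ u - σ / γ * (x ⬝ᵥ x) - γ * σ * (X *ᵥ x ⬝ᵥ X *ᵥ x)
      + 2 * (X *ᵥ x ⬝ᵥ w)) = γ * E - γ * (u ⬝ᵥ u) - σ * (x ⬝ᵥ x)
      - γ ^ 2 * σ * (X *ᵥ x ⬝ᵥ X *ᵥ x) + 2 * γ * (X *ᵥ x ⬝ᵥ w) := by
    field_simp
  rw [h6]
  rw [h5] at h4
  linarith

/-- Since `1 - gXZ = (Z⁻¹ - gX)Z`, the gain `L` is `(Z⁻¹ - gX)⁻¹Cᵀ`: output injection enters the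
error storage through `Ce` only. -/
theorem observer_gain_identity {p : Type*} {X Z : Matrix n n ℝ} {C : Matrix p n ℝ} {g : ℝ} (hZ : Z.PosDef)
    (hQ : (Z⁻¹ - g • X).PosDef) :
    (Z⁻¹ - g • X) * (Z * (1 - g • (X * Z))⁻¹ * Cᵀ) = Cᵀ := by
  have hZu := hZ.det_pos.ne'.isUnit
  have hQu := hQ.det_pos.ne'.isUnit
  have h1 : 1 - g • (X * Z) = (Z⁻¹ - g • X) * Z := by
    rw [sub_mul, Matrix.nonsing_inv_mul _ hZu, Matrix.smul_mul]
  rw [h1, Matrix.mul_inv_rev, ← Matrix.mul_assoc Z, Matrix.mul_nonsing_inv _ hZu, one_mul,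
    ← Matrix.mul_assoc, Matrix.mul_nonsing_inv _ hQu, Matrix.one_mul]

open scoped MatrixOrder in
theorem exists_le_quadForm {P : Matrix n n ℝ} (hP : P.PosDef) :
    ∃ c : ℝ, 0 < c ∧ ∀ x : n → ℝ, c * (x ⬝ᵥ x) ≤ x ⬝ᵥ P *ᵥ x := by
  obtain ⟨D, hD⟩ := CStarAlgebra.nonneg_iff_eq_star_mul_self.mp hP.posSemidef.nonneg
  rw [Matrix.star_eq_conjTranspose, Matrix.conjTranspose_eq_transpose_of_trivial] at hD
  have hDdet : IsUnit D.det := by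
    have h := hP.det_pos
    rw [hD, Matrix.det_mul] at h
    exact isUnit_iff_ne_zero.2 fun h0 => by simp [h0] at h
  -- With `P = DᵀD`, an upper bound for the form of `D⁻¹` at `Dx` is a lower bound for that of `P`
  -- at `x`; `c + 1` guards against `c = 0`.
  obtain ⟨c, hc0, hc⟩ := exists_quadForm_le ((D⁻¹)ᵀ * D⁻¹)
  refine ⟨(c + 1)⁻¹, by positivity, fun x => ?_⟩
  have h1 := hc (D *ᵥ x)
  have hform : ∀ (M : Matrix n n ℝ) (y : n → ℝ), y ⬝ᵥ (Mᵀ * M) *ᵥ y = M *ᵥ y ⬝ᵥ M *ᵥ y := by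
    intro M y
    rw [← Matrix.mulVec_mulVec, Matrix.dotProduct_mulVec, ← Matrix.mulVec_transpose,
      Matrix.transpose_transpose]
  rw [hform, Matrix.mulVec_mulVec, Matrix.nonsing_inv_mul _ hDdet, Matrix.one_mulVec,
    ← hform D, ← hD] at h1
  have h2 : 0 ≤ x ⬝ᵥ P *ᵥ x := by
    rw [hD, hform]
    exact dotProduct_self_nonneg _
  rw [inv_mul_le_iff₀ (by positivity)]
  linarith

end Matrices

/-! ### Modal equations -/

theorem pair_const_mul (v : L2) (c : ℝ) (φ : ℝ → ℝ) :
    pair v (fun x => c * φ x) = c * pair v φ := by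
  unfold pair
  rw [← integral_const_mul]
  congr 1
  funext x
  ring

theorem continuous_pair_eigenfun (n : ℕ) : Continuous fun v : L2 => pair v (eigenfun n) := by
  simp_rw [pair_eigenfun]
  fun_prop

theorem continuous_modes (N : ℕ) : Continuous (modes N) :=
  continuous_pi fun n => continuous_pair_eigenfun n

theorem modes_dotProduct_self (N : ℕ) (v : L2) :
    modes N v ⬝ᵥ modes N v = ∑ n ∈ Finset.range N, pair v (eigenfun n) ^ 2 := by
  rw [← Fin.sum_univ_eq_sum_range (fun n => pair v (eigenfun n) ^ 2)]
  exact Finset.sum_congr rfl fun n _ => (sq _).symm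

theorem modes_dotProduct_self_le (N : ℕ) (v : L2) : modes N v ⬝ᵥ modes N v ≤ ‖v‖ ^ 2 := by
  rw [modes_dotProduct_self]
  exact sum_le_hasSum _ (fun _ _ => sq_nonneg _) (hasSum_pair_sq v)

theorem IsHeatSolution.hasDerivAt_pair {q : ℝ} {f : ℝ → L2 → L2} {u : ℝ → ℝ} {z : ℝ → L2}
    (hz : IsHeatSolution q f u z) (n : ℕ) {t : ℝ} (ht : 0 < t) :
    HasDerivAt (fun s => pair (z s) (eigenfun n))
      ((q - (n : ℝ) ^ 2) * pair (z t) (eigenfun n) + eigenfun n Real.pi * u t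
        + pair (f t (z t)) (eigenfun n)) t := by
  have h := hz.weak_eq (eigenfun n) (contDiff_eigenfun n) (deriv_eigenfun_zero n)
    (deriv_eigenfun_pi n) t ht
  rw [deriv_deriv_eigenfun, pair_const_mul] at h
  exact h.congr_deriv (by ring)

theorem IsHeatSolution.hasDerivAt_modes {q : ℝ} {f : ℝ → L2 → L2} {u : ℝ → ℝ} {z : ℝ → L2}
    (hz : IsHeatSolution q f u z) (N : ℕ) {t : ℝ} (ht : 0 < t) :
    HasDerivAt (fun s => modes N (z s))
      (matA N q *ᵥ modes N (z t) + matB N *ᵥ ![u t] + modes N (f t (z t))) t := by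
  refine hasDerivAt_pi.2 fun n => ?_
  refine (hz.hasDerivAt_pair n ht).congr_deriv ?_
  rw [Pi.add_apply, Pi.add_apply, matA, Matrix.mulVec_diagonal]
  simp [matB, modes, mul_comm]

theorem IsAdmissible.norm_le {σ : ℝ} {f : ℝ → L2 → L2} (hf : IsAdmissible σ f) {t : ℝ}
    (ht : 0 ≤ t) (v : L2) : ‖f t v‖ ≤ σ * ‖v‖ := by
  simpa [hf.map_zero t ht] using hf.lipschitz t ht v 0

/-- Energy bound for a stable scalar linear equation. -/
theorem sq_le_of_hasDerivAt_linear {a g h : ℝ → ℝ} {r G t : ℝ} (hr : 0 < r) (ht : 0 ≤ t)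
    (ha : ContinuousOn a (Icc 0 t)) (hh : Continuous h)
    (hderiv : ∀ s ∈ Ioo 0 t, HasDerivAt a (-r * a s + g s) s)
    (hg : ∀ s ∈ Ioo 0 t, g s ^ 2 ≤ 2 * G ^ 2 + 2 * h s ^ 2) :
    a t ^ 2 ≤ Real.exp (-(r * t)) * a 0 ^ 2 + 2 * G ^ 2 / r ^ 2
      + 2 / r * ∫ s in (0 : ℝ)..t, h s ^ 2 := by
  -- Integrating factor: Young's inequality `2ag ≤ ra² + g²/r` spends half of the decay rate `2r` of
  -- `a²`. The weight `exp (r * t)` at the final time dominates `exp (r * s)`, so `ψ` decreases.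
  let ψ : ℝ → ℝ := fun s => Real.exp (r * s) * (a s ^ 2 - 2 * G ^ 2 / r ^ 2)
    - Real.exp (r * t) * (2 / r) * ∫ s in (0 : ℝ)..s, h s ^ 2
  have hH : ∀ s, HasDerivAt (fun s => ∫ s in (0 : ℝ)..s, h s ^ 2) (h s ^ 2) s := fun s =>
    ((hh.pow 2).integral_hasStrictDerivAt 0 s).hasDerivAt
  have hHc : Continuous fun s => ∫ s in (0 : ℝ)..s, h s ^ 2 :=
    continuous_iff_continuousAt.2 fun s => (hH s).continuousAt
  have hψc : ContinuousOn ψ (Icc 0 t) := by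
    refine ContinuousOn.sub (ContinuousOn.mul (by fun_prop) ?_) (by fun_prop)
    exact (ha.pow 2).sub continuousOn_const
  have hψd : ∀ s ∈ Ioo 0 t, HasDerivAt ψ
      (Real.exp (r * s) * r * (a s ^ 2 - 2 * G ^ 2 / r ^ 2)
        + Real.exp (r * s) * (2 * a s * (-r * a s + g s))
        - Real.exp (r * t) * (2 / r) * h s ^ 2) s := by
    intro s hs
    have h1 : HasDerivAt (fun s => Real.exp (r * s)) (Real.exp (r * s) * r) s := by
      simpa using ((hasDerivAt_id s).const_mul r).exp
    have h2 : HasDerivAt (fun s => a s ^ 2 - 2 * G ^ 2 / r ^ 2)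
        (2 * a s * (-r * a s + g s)) s := by
      simpa using ((hderiv s hs).fun_pow 2).sub_const (2 * G ^ 2 / r ^ 2)
    exact (h1.mul h2).sub ((hH s).const_mul _)
  have hanti : AntitoneOn ψ (Icc 0 t) := by
    refine antitoneOn_of_deriv_nonpos (convex_Icc 0 t) hψc ?_ ?_
    · rw [interior_Icc]
      exact fun s hs => (hψd s hs).differentiableAt.differentiableWithinAt
    · rw [interior_Icc]
      intro s hs
      rw [(hψd s hs).deriv]
      have h1 : 2 * a s * g s ≤ r * a s ^ 2 + g s ^ 2 / r := by
        have : 0 ≤ (r * a s - g s) ^ 2 / r := by positivity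
        have h2 : (r * a s - g s) ^ 2 / r = r * a s ^ 2 - 2 * a s * g s + g s ^ 2 / r := by
          field_simp
          ring
        linarith
      have h2 : g s ^ 2 / r ≤ (2 * G ^ 2 + 2 * h s ^ 2) / r :=
        div_le_div_of_nonneg_right (hg s hs) hr.le
      have h3 : r * (a s ^ 2 - 2 * G ^ 2 / r ^ 2) + 2 * a s * (-r * a s + g s) ≤
          2 / r * h s ^ 2 := by
        have h4 : r * (2 * G ^ 2 / r ^ 2) = 2 * G ^ 2 / r := by field_simp
        have h5 : (2 * G ^ 2 + 2 * h s ^ 2) / r = 2 * G ^ 2 / r + 2 / r * h s ^ 2 := by ring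
        rw [mul_sub, h4]
        nlinarith
      have h4 : Real.exp (r * s) ≤ Real.exp (r * t) := by
        have := hs.2.le
        gcongr
      have h5 := mul_le_mul_of_nonneg_left h3 (Real.exp_pos (r * s)).le
      have h6 : Real.exp (r * s) * (2 / r * h s ^ 2) ≤ Real.exp (r * t) * (2 / r * h s ^ 2) := by
        gcongr
      linarith
  have h1 := hanti (left_mem_Icc.2 ht) (right_mem_Icc.2 ht) ht
  simp only [ψ, mul_zero, Real.exp_zero, one_mul, intervalIntegral.integral_same, sub_zero] at h1
  set I := ∫ s in (0 : ℝ)..t, h s ^ 2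
  have h2 : 0 ≤ 2 * G ^ 2 / r ^ 2 := by positivity
  have h3 : Real.exp (r * t) * (a t ^ 2 - 2 * G ^ 2 / r ^ 2 - 2 / r * I) ≤ a 0 ^ 2 := by
    linarith
  have h4 := mul_le_mul_of_nonneg_left h3 (Real.exp_pos (-(r * t))).le
  rw [← mul_assoc, ← Real.exp_add, neg_add_cancel, Real.exp_zero, one_mul] at h4
  linarith

theorem abs_le_of_sq_le_add {a b c d : ℝ} (hb : 0 ≤ b) (hc : 0 ≤ c) (hd : 0 ≤ d)
    (h : a ^ 2 ≤ b ^ 2 + c ^ 2 + d ^ 2) : |a| ≤ b + c + d := by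
  refine abs_le_of_sq_le_sq (h.trans ?_) (by positivity)
  nlinarith [mul_nonneg hb hc, mul_nonneg hb hd, mul_nonneg hc hd]

/-- The integrals of the squared modes of a continuous curve are summable. -/
theorem summable_integral_pair_sq {F : ℝ → L2} (hF : Continuous F) {T : ℝ} (hT : 0 ≤ T) :
    Summable fun n => ∫ s in (0 : ℝ)..T, pair (F s) (eigenfun n) ^ 2 := by
  have hc : ∀ n, Continuous fun s => pair (F s) (eigenfun n) ^ 2 := fun n =>
    ((continuous_pair_eigenfun n).comp hF).pow 2
  refine summable_of_sum_le (c := ∫ s in (0 : ℝ)..T, ‖F s‖ ^ 2)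
    (fun n => intervalIntegral.integral_nonneg hT fun _ _ => sq_nonneg _) fun S => ?_
  rw [← intervalIntegral.integral_finsetSum fun n _ => (hc n).intervalIntegrable _ _]
  refine intervalIntegral.integral_mono_on hT
    (Continuous.intervalIntegrable (continuous_finsetSum _ fun n _ => hc n) _ _)
    (Continuous.intervalIntegrable (by fun_prop) _ _) fun s _ => ?_
  exact sum_le_hasSum S (fun _ _ => sq_nonneg _) (hasSum_pair_sq (F s))

/-- Parabolic smoothing: away from `t = 0` the modes of a solution are absolutely summable, locally
uniformly in time. -/
theorem IsHeatSolution.exists_summable_mode_bound {q σ : ℝ} {f : ℝ → L2 → L2} {u : ℝ → ℝ}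
    {z : ℝ → L2} (hz : IsHeatSolution q f u z) (hf : IsAdmissible σ f)
    (hu : ContinuousOn u (Ici 0)) {N : ℕ} (hq : 0 ≤ q) (hN : q < (N : ℝ) ^ 2) {t₀ T : ℝ}
    (ht₀ : 0 < t₀) (hT : t₀ ≤ T) :
    ∃ a : ℕ → ℝ, Summable a ∧
      ∀ k, ∀ t ∈ Icc t₀ T, |pair (z t) (eigenfun (k + N))| ≤ a k := by
  have hsqrt : √q < N := by
    rw [Real.sqrt_lt' (lt_of_pow_lt_pow_left₀ 2 (Nat.cast_nonneg N) (by simpa using hq.trans_lt hN))]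
    exact hN
  have hr : ∀ k : ℕ, 0 < ((k + N : ℕ) : ℝ) ^ 2 - q := by
    intro k
    have := sq_sub_sq_pos (s := √q) (by rwa [abs_of_nonneg (Real.sqrt_nonneg q)])
      (Nat.le_add_left N k)
    rwa [Real.sq_sqrt hq] at this
  have hT0 : 0 ≤ T := ht₀.le.trans hT
  obtain ⟨G, hG⟩ := (isCompact_Icc (a := (0 : ℝ)) (b := T)).exists_bound_of_continuousOn
    (hu.mono Icc_subset_Ici_self)
  have hG0 : 0 ≤ G := (norm_nonneg _).trans (hG 0 (left_mem_Icc.2 hT0))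
  -- Freezing time at `0` for `s < 0` makes the forcing continuous on the whole line.
  let F : ℝ → L2 := fun s => f (max s 0) (z (max s 0))
  have hmax : Continuous fun s : ℝ => max s 0 := by fun_prop
  have hzc : Continuous fun s => z (max s 0) :=
    hz.continuousOn.comp_continuous hmax fun s => le_max_right s 0
  have hF : Continuous F :=
    hf.continuousOn.comp_continuous (hmax.prodMk hzc) fun s => ⟨le_max_right s 0, mem_univ _⟩
  let H : ℕ → ℝ := fun n => ∫ s in (0 : ℝ)..T, pair (F s) (eigenfun n) ^ 2
  -- With `r = n² - q`, the initial datum contributes through `exp(-rt/2) ≤ 2/(t₀r)`, the input at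
  -- most `2G/r`, and the forcing `√(2I/r) ≤ r⁻¹ + I` with `I ≤ H n`. Both `r⁻¹` and `H` are
  -- summable.
  refine ⟨fun k => (2 * ‖z 0‖ / t₀ + 2 * G + 1) * (((k + N : ℕ) : ℝ) ^ 2 - q)⁻¹ + H (k + N),
    Summable.add ?_ ?_, fun k t ht => ?_⟩
  · have h := summable_inv_sq_sub_sq N (Real.sqrt_nonneg q) hsqrt
    rw [Real.sq_sqrt hq] at h
    exact h.mul_left _
  · exact (summable_nat_add_iff N).2 (summable_integral_pair_sq hF hT0)
  have ht0 : 0 < t := ht₀.trans_le ht.1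
  set r : ℝ := ((k + N : ℕ) : ℝ) ^ 2 - q with hrdef
  have hr0 : 0 < r := hr k
  have hFc : Continuous fun s => pair (F s) (eigenfun (k + N)) :=
    (continuous_pair_eigenfun _).comp hF
  have hHle : ∫ s in (0 : ℝ)..t, pair (F s) (eigenfun (k + N)) ^ 2 ≤ H (k + N) :=
    intervalIntegral.integral_mono_interval le_rfl ht0.le ht.2
      (ae_of_all _ fun _ => sq_nonneg _) ((hFc.pow 2).intervalIntegrable _ _)
  have hH0 : 0 ≤ ∫ s in (0 : ℝ)..t, pair (F s) (eigenfun (k + N)) ^ 2 :=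
    intervalIntegral.integral_nonneg ht0.le fun _ _ => sq_nonneg _
  have hmain := sq_le_of_hasDerivAt_linear (a := fun s => pair (z s) (eigenfun (k + N)))
    (g := fun s => eigenfun (k + N) Real.pi * u s + pair (f s (z s)) (eigenfun (k + N)))
    (h := fun s => pair (F s) (eigenfun (k + N))) (G := G) hr0 ht0.le
    ((continuous_pair_eigenfun _).comp_continuousOn (hz.continuousOn.mono Icc_subset_Ici_self))
    hFc (fun s hs => (hz.hasDerivAt_pair (k + N) hs.1).congr_deriv (by rw [hrdef]; ring)) ?_
  · set I := ∫ s in (0 : ℝ)..t, pair (F s) (eigenfun (k + N)) ^ 2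
    have h1 : |pair (z t) (eigenfun (k + N))| ≤
        Real.exp (-(r * t) / 2) * |pair (z 0) (eigenfun (k + N))| + 2 * G * r⁻¹ + (r⁻¹ + I) := by
      refine abs_le_of_sq_le_add (by positivity) (by positivity) (by positivity) (hmain.trans ?_)
      refine add_le_add (add_le_add ?_ ?_) ?_
      · rw [mul_pow, ← Real.exp_nat_mul, sq_abs]
        refine le_of_eq ?_
        congr 2
        push_cast
        ring
      · rw [mul_pow, mul_pow, inv_pow, div_eq_mul_inv]
        have : 0 ≤ G ^ 2 * (r ^ 2)⁻¹ := by positivity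
        linarith
      · rw [div_eq_mul_inv]
        nlinarith [sq_nonneg r⁻¹, sq_nonneg I]
    have h2 : |pair (z 0) (eigenfun (k + N))| ≤ ‖z 0‖ := by
      refine abs_le_of_sq_le_sq ?_ (norm_nonneg _)
      exact le_hasSum (hasSum_pair_sq (z 0)) (k + N) fun _ _ => sq_nonneg _
    have h3 : Real.exp (-(r * t) / 2) ≤ 2 / t₀ * r⁻¹ := by
      have h4 : r * t₀ / 2 ≤ Real.exp (r * t / 2) := by
        have h5 := Real.add_one_le_exp (r * t / 2)
        have h6 : r * t₀ ≤ r * t := by gcongr; exact ht.1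
        linarith
      rw [neg_div, Real.exp_neg]
      refine (inv_anti₀ (by positivity) h4).trans (le_of_eq ?_)
      field_simp
    have h4 : Real.exp (-(r * t) / 2) * |pair (z 0) (eigenfun (k + N))| ≤
        2 / t₀ * r⁻¹ * ‖z 0‖ := by gcongr
    have h5 : (2 * ‖z 0‖ / t₀ + 2 * G + 1) * r⁻¹ =
        2 / t₀ * r⁻¹ * ‖z 0‖ + 2 * G * r⁻¹ + r⁻¹ := by ring
    change _ ≤ (2 * ‖z 0‖ / t₀ + 2 * G + 1) * r⁻¹ + H (k + N)
    rw [h5]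
    linarith
  · intro s hs
    have hFs : F s = f s (z s) := by simp [F, max_eq_left hs.1.le]
    have h1 : |u s| ≤ G := hG s ⟨hs.1.le, hs.2.le.trans ht.2⟩
    have h2 : (eigenfun (k + N) Real.pi * u s) ^ 2 ≤ G ^ 2 := by
      refine sq_le_sq' ?_ ?_
      all_goals
        have h3 : |eigenfun (k + N) Real.pi * u s| ≤ G := by
          rw [abs_mul]
          exact (mul_le_of_le_one_left (abs_nonneg _) (abs_eigenfun_le _ _)).trans h1
        have := abs_le.1 h3
        linarith [this.1, this.2]
    simp only [hFs]
    nlinarith [sq_nonneg (eigenfun (k + N) Real.pi * u s - pair (f s (z s)) (eigenfun (k + N)))]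

/-- Dissipation inequality for the high modes. -/
theorem high_mode_dissipation {N : ℕ} {q σ γ d : ℝ} (hσ : 0 < σ) (hd : |d| < N)
    (hdq : d ^ 2 = q + σ) (hγ : γ = residueSeries N d) (hN : N ≠ 0) (m : ℕ) (z f : ℕ → ℝ) (u : ℝ) :
    ∑ n ∈ Finset.Ico N m,
        2 * (z n * ((q - (n : ℝ) ^ 2) * z n + eigenfun n Real.pi * u + f n)) ≤
      γ * u ^ 2 + σ⁻¹ * ∑ n ∈ Finset.Ico N m, f n ^ 2 - σ * ∑ n ∈ Finset.Ico N m, z n ^ 2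
        - γ⁻¹ * (∑ n ∈ Finset.Ico N m, eigenfun n 0 * z n) ^ 2 := by
  have hγ0 : 0 < γ := hγ ▸ residueSeries_pos hd
  have hb := sq_sum_mul_le_residueSeries hd m (fun n => eigenfun n Real.pi) z
    (fun n hn => eigenfun_pi_sq (by omega))
  have hc := sq_sum_mul_le_residueSeries hd m (fun n => eigenfun n 0) z
    (fun n hn => eigenfun_zero_sq (by omega))
  rw [← hγ] at hb hc
  set S := ∑ n ∈ Finset.Ico N m, ((n : ℝ) ^ 2 - d ^ 2) * z n ^ 2 with hS
  set P := ∑ n ∈ Finset.Ico N m, eigenfun n Real.pi * z n with hP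
  set R := ∑ n ∈ Finset.Ico N m, eigenfun n 0 * z n
  -- From `q - n² = -(n² - d²) - σ` a decay `2σz²` is left over; Young's inequality for `f` uses
  -- half of it.
  have h1 : ∑ n ∈ Finset.Ico N m,
        2 * (z n * ((q - (n : ℝ) ^ 2) * z n + eigenfun n Real.pi * u + f n)) ≤
      -2 * S + 2 * u * P + σ⁻¹ * ∑ n ∈ Finset.Ico N m, f n ^ 2
        - σ * ∑ n ∈ Finset.Ico N m, z n ^ 2 := by
    rw [hS, hP, Finset.mul_sum, Finset.mul_sum, Finset.mul_sum, Finset.mul_sum,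
      ← Finset.sum_add_distrib, ← Finset.sum_add_distrib, ← Finset.sum_sub_distrib]
    refine Finset.sum_le_sum fun n _ => ?_
    have h2 : 0 ≤ σ⁻¹ * (σ * z n - f n) ^ 2 := by positivity
    have h3 : σ⁻¹ * (σ * z n - f n) ^ 2 = σ * z n ^ 2 - 2 * (z n * f n) + σ⁻¹ * f n ^ 2 := by
      field_simp
      ring
    rw [hdq]
    linarith
  have h2 : 2 * u * P ≤ γ * u ^ 2 + γ⁻¹ * P ^ 2 := by
    have h3 : 0 ≤ γ⁻¹ * (γ * u - P) ^ 2 := by positivity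
    have h4 : γ⁻¹ * (γ * u - P) ^ 2 = γ * u ^ 2 - 2 * u * P + γ⁻¹ * P ^ 2 := by
      field_simp
      ring
    linarith
  -- One copy of `S` in `-2S` pays for the input trace `P`, the other supplies the output term
  -- `-γ⁻¹R²`.
  have h3 : γ⁻¹ * P ^ 2 ≤ S := by rwa [inv_mul_le_iff₀ hγ0]
  have h4 : γ⁻¹ * R ^ 2 ≤ S := by rwa [inv_mul_le_iff₀ hγ0]
  linarith

/-! ### The Lyapunov function of the closed loop -/

/-- Quadratic storage of the truncated plant state `x` and of the observer error `e`. -/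
noncomputable def storage {N : ℕ} (γ : ℝ) (X Z : Matrix (Fin N) (Fin N) ℝ) (x e : Fin N → ℝ) : ℝ :=
  γ * (x ⬝ᵥ X *ᵥ x) + γ⁻¹ * (e ⬝ᵥ (Z⁻¹ - γ ^ 2 • X) *ᵥ e)

theorem continuous_storage {N : ℕ} (γ : ℝ) (X Z : Matrix (Fin N) (Fin N) ℝ) :
    Continuous fun p : (Fin N → ℝ) × (Fin N → ℝ) => storage γ X Z p.1 p.2 :=
  (continuous_const.mul ((continuous_quadForm X).comp continuous_fst)).add
    (continuous_const.mul ((continuous_quadForm _).comp continuous_snd))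

/-- The energy of the closed loop: the storage of the low modes plus the energy of the high modes. -/
noncomputable def energy {N : ℕ} (γ : ℝ) (X Z : Matrix (Fin N) (Fin N) ℝ) (v : L2)
    (xhat : Fin N → ℝ) : ℝ :=
  storage γ X Z (modes N v) (xhat - modes N v) + (‖v‖ ^ 2 - modes N v ⬝ᵥ modes N v)

theorem continuous_energy {N : ℕ} (γ : ℝ) (X Z : Matrix (Fin N) (Fin N) ℝ) :
    Continuous fun p : L2 × (Fin N → ℝ) => energy γ X Z p.1 p.2 := by
  have hm : Continuous fun p : L2 × (Fin N → ℝ) => modes N p.1 :=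
    (continuous_modes N).comp continuous_fst
  refine ((continuous_storage γ X Z).comp (hm.prodMk (continuous_snd.sub hm))).add
    (Continuous.sub (by fun_prop) (hm.dotProduct hm))

theorem exists_le_energy {N : ℕ} {γ : ℝ} {X Z : Matrix (Fin N) (Fin N) ℝ} (hγ : 0 < γ)
    (hX : X.PosDef) (hQ : (Z⁻¹ - γ ^ 2 • X).PosDef) :
    ∃ c : ℝ, 0 < c ∧ ∀ (v : L2) (xhat : Fin N → ℝ),
      c * (‖v‖ ^ 2 + (xhat - modes N v) ⬝ᵥ (xhat - modes N v)) ≤ energy γ X Z v xhat := by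
  obtain ⟨a, ha, hXa⟩ := exists_le_quadForm hX
  obtain ⟨b, hb, hQb⟩ := exists_le_quadForm hQ
  refine ⟨min (min (γ * a) 1) (γ⁻¹ * b), by positivity, fun v xhat => ?_⟩
  set c := min (min (γ * a) 1) (γ⁻¹ * b)
  have hc1 : c ≤ γ * a := (min_le_left _ _).trans (min_le_left _ _)
  have hc2 : c ≤ 1 := (min_le_left _ _).trans (min_le_right _ _)
  have hc3 : c ≤ γ⁻¹ * b := min_le_right _ _
  have h1 := mul_le_mul_of_nonneg_left (hXa (modes N v)) hγ.le
  have h2 := mul_le_mul_of_nonneg_left (hQb (xhat - modes N v)) (inv_pos.2 hγ).le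
  have h3 := modes_dotProduct_self_le N v
  have h4 := mul_le_mul_of_nonneg_right hc1 (dotProduct_self_nonneg (modes N v))
  have h5 := mul_le_mul_of_nonneg_right hc2 (sub_nonneg.2 h3)
  have h6 := mul_le_mul_of_nonneg_right hc3 (dotProduct_self_nonneg (xhat - modes N v))
  unfold energy storage
  linarith

theorem exists_energy_zero_le {N : ℕ} {γ : ℝ} (X Z : Matrix (Fin N) (Fin N) ℝ) (hγ : 0 < γ) :
    ∃ c : ℝ, 0 ≤ c ∧ ∀ v : L2, energy γ X Z v 0 ≤ c * ‖v‖ ^ 2 := by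
  obtain ⟨a, ha, hXa⟩ := exists_quadForm_le X
  obtain ⟨b, hb, hQb⟩ := exists_quadForm_le (Z⁻¹ - γ ^ 2 • X)
  refine ⟨γ * a + γ⁻¹ * b + 1, by positivity, fun v => ?_⟩
  have h1 := mul_le_mul_of_nonneg_left (hXa (modes N v)) hγ.le
  have h2 := mul_le_mul_of_nonneg_left (hQb (0 - modes N v)) (inv_pos.2 hγ).le
  have h3 := modes_dotProduct_self_le N v
  have h4 := mul_le_mul_of_nonneg_left h3 (show 0 ≤ γ * a + γ⁻¹ * b by positivity)
  have h5 := dotProduct_self_nonneg (modes N v)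
  have h6 : (0 - modes N v) ⬝ᵥ (0 - modes N v) = modes N v ⬝ᵥ modes N v := by
    rw [zero_sub, neg_dotProduct_neg]
  rw [h6] at h2
  unfold energy storage
  linarith

/-- The data of the theorem that enter the Lyapunov argument. -/
structure IsRiccatiPair (N : ℕ) (q σ γ : ℝ) (X Z : Matrix (Fin N) (Fin N) ℝ) : Prop where
  posDef_control : X.PosDef
  posDef_filter : Z.PosDef
  control : X * matA N q + (matA N q)ᵀ * X
    - X * (matB N * (matB N)ᵀ - (γ * σ) • (1 : Matrix (Fin N) (Fin N) ℝ)) * X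
    + (σ / γ) • (1 : Matrix (Fin N) (Fin N) ℝ) = 0
  filter : Z * (matA N q)ᵀ + matA N q * Z
    - Z * ((matC N)ᵀ * matC N - (γ * σ) • (1 : Matrix (Fin N) (Fin N) ℝ)) * Z
    + (σ / γ) • (1 : Matrix (Fin N) (Fin N) ℝ) = 0
  posDef_coupling : (Z⁻¹ - γ ^ 2 • X).PosDef

/-! ### Monotonicity of the energy along closed-loop solutions -/

variable {N : ℕ} {q σ γ d : ℝ} {X Z : Matrix (Fin N) (Fin N) ℝ} {f : ℝ → L2 → L2} {z : ℝ → L2}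
  {zhat : ℝ → Fin N → ℝ} {u y : ℝ → ℝ}

theorem IsClosedLoopSolution.continuousOn_input
    {K : Matrix (Fin 1) (Fin N) ℝ} {L : Matrix (Fin N) (Fin 1) ℝ}
    (hs : IsClosedLoopSolution N q σ γ X K L f z zhat u y) : ContinuousOn u (Ici 0) := by
  have h : ContinuousOn (fun t => -(K *ᵥ zhat t) 0) (Ici 0) := by
    have hK : Continuous fun v : Fin N → ℝ => -(K *ᵥ v) 0 :=
      ((continuous_apply 0).comp (Continuous.matrix_mulVec continuous_const continuous_id)).neg
    exact hK.comp_continuousOn hs.zhat_continuousOn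
  exact h.congr fun t ht => hs.control t ht

theorem hasDerivAt_storage (hR : IsRiccatiPair N q σ γ X Z) {x e : ℝ → Fin N → ℝ}
    {x' e' : Fin N → ℝ} {t : ℝ} (hx : HasDerivAt x x' t) (he : HasDerivAt e e' t) :
    HasDerivAt (fun s => storage γ X Z (x s) (e s))
      (γ * (2 * (x t ⬝ᵥ X *ᵥ x')) + γ⁻¹ * (2 * (e t ⬝ᵥ (Z⁻¹ - γ ^ 2 • X) *ᵥ e'))) t := by
  have hX : Xᵀ = X := by simpa using hR.posDef_control.isHermitian.eq
  have hQ : (Z⁻¹ - γ ^ 2 • X)ᵀ = Z⁻¹ - γ ^ 2 • X := by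
    simpa using hR.posDef_coupling.isHermitian.eq
  exact ((hasDerivAt_quadForm hX hx).const_mul γ).add ((hasDerivAt_quadForm hQ he).const_mul γ⁻¹)

/-- Dissipation of the storage of the low modes together with the energy of finitely many high
modes. The right-hand side vanishes as the number of modes grows. -/
theorem exists_deriv_storage_le (hσ : 0 < σ) (hd : |d| < N) (hdq : d ^ 2 = q + σ)
    (hγ : γ = residueSeries N d) (hR : IsRiccatiPair N q σ γ X Z) (hf : IsAdmissible σ f)
    (hs : IsClosedLoopSolution N q σ γ X (gainK N X) (gainL N γ X Z) f z zhat u y)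
    (m : ℕ) (hm : N ≤ m) {t : ℝ} (ht : 0 < t) :
    ∃ D : ℝ, HasDerivAt (fun s => storage γ X Z (modes N (z s)) (zhat s - modes N (z s))
        + ∑ n ∈ Finset.Ico N m, pair (z s) (eigenfun n) ^ 2) D t ∧
      D ≤ γ⁻¹ * ((y t - ∑ n ∈ Finset.range N, eigenfun n 0 * pair (z t) (eigenfun n)) ^ 2
          - (∑ n ∈ Finset.Ico N m, eigenfun n 0 * pair (z t) (eigenfun n)) ^ 2)
        + σ * (‖z t‖ ^ 2 - ∑ n ∈ Finset.range m, pair (z t) (eigenfun n) ^ 2) := by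
  have hγ0 : 0 < γ := hγ ▸ residueSeries_pos hd
  have hN : N ≠ 0 := by
    rintro rfl
    exact absurd hd (by simp)
  have hX : Xᵀ = X := by simpa using hR.posDef_control.isHermitian.eq
  have hL : (Z⁻¹ - γ ^ 2 • X) * gainL N γ X Z = (matC N)ᵀ :=
    observer_gain_identity hR.posDef_filter hR.posDef_coupling
  have hx := hs.heat.hasDerivAt_modes N ht
  have he := (hs.observer t ht).sub hx
  have hhigh : HasDerivAt (fun s => ∑ n ∈ Finset.Ico N m, pair (z s) (eigenfun n) ^ 2)
      (∑ n ∈ Finset.Ico N m, 2 * (pair (z t) (eigenfun n) *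
        ((q - (n : ℝ) ^ 2) * pair (z t) (eigenfun n) + eigenfun n Real.pi * u t
          + pair (f t (z t)) (eigenfun n)))) t := by
    refine HasDerivAt.fun_sum fun n _ => ?_
    refine ((hs.heat.hasDerivAt_pair n ht).fun_pow 2).congr_deriv ?_
    push_cast
    ring
  refine ⟨_, (hasDerivAt_storage hR hx he).add hhigh, ?_⟩
  have hu : ![u t] = -(((matB N)ᵀ * X) *ᵥ zhat t) := by
    funext i
    fin_cases i
    exact hs.control t ht.le
  have h1 := storage_dissipation hγ0 hσ hX hR.posDef_filter hR.control hR.filter hL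
    (modes N (z t)) (zhat t) (modes N (f t (z t))) ![u t] ![y t] hu
  have h2 := high_mode_dissipation hσ hd hdq hγ hN m (fun n => pair (z t) (eigenfun n))
    (fun n => pair (f t (z t)) (eigenfun n)) (u t)
  have h3 : ![u t] ⬝ᵥ ![u t] = u t ^ 2 := by simp [sq]
  have h4 : (![y t] - matC N *ᵥ modes N (z t)) ⬝ᵥ (![y t] - matC N *ᵥ modes N (z t)) =
      (y t - ∑ n ∈ Finset.range N, eigenfun n 0 * pair (z t) (eigenfun n)) ^ 2 := by
    rw [← Fin.sum_univ_eq_sum_range (fun n => eigenfun n 0 * pair (z t) (eigenfun n))]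
    simp [dotProduct, Matrix.mulVec, matC, modes, sq]
  rw [h3, h4, modes_dotProduct_self, modes_dotProduct_self] at h1
  -- The nonlinearity couples low and high modes, so its norm bound is usable only for both
  -- together; this is why both parts carry the same weight `σ⁻¹`.
  have h5 : ∑ n ∈ Finset.range N, pair (f t (z t)) (eigenfun n) ^ 2 +
      ∑ n ∈ Finset.Ico N m, pair (f t (z t)) (eigenfun n) ^ 2 ≤ σ ^ 2 * ‖z t‖ ^ 2 := by
    rw [Finset.sum_range_add_sum_Ico _ hm, ← mul_pow]
    refine (sum_le_hasSum _ (fun _ _ => sq_nonneg _) (hasSum_pair_sq (f t (z t)))).trans ?_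
    have := hf.norm_le ht.le (z t)
    gcongr
  have h6 := Finset.sum_range_add_sum_Ico (fun n => pair (z t) (eigenfun n) ^ 2) hm
  have h7 := mul_le_mul_of_nonneg_left h5 (inv_pos.2 hσ).le
  have h8 : σ⁻¹ * (σ ^ 2 * ‖z t‖ ^ 2) = σ * ‖z t‖ ^ 2 := by field_simp
  rw [h8] at h7
  rw [← h6]
  refine (add_le_add h1 h2).trans ?_
  linarith

theorem sq_sub_sq_le_of_abs_le {a b c e : ℝ} (ha : |a| ≤ c) (hb : |b| ≤ c) (hab : |a - b| ≤ e) :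
    a ^ 2 - b ^ 2 ≤ 2 * c * e := by
  have hc : 0 ≤ c := (abs_nonneg a).trans ha
  have h1 : |a + b| ≤ 2 * c := (abs_add_le a b).trans (by linarith)
  calc a ^ 2 - b ^ 2 = (a + b) * (a - b) := by ring
    _ ≤ |a + b| * |a - b| := by rw [← abs_mul]; exact le_abs_self _
    _ ≤ 2 * c * e := mul_le_mul h1 hab (abs_nonneg _) (by linarith)

/-- The energy does not increase between positive times. -/
theorem energy_le_of_pos (hq : 0 ≤ q) (hσ : 0 < σ) (hd : |d| < N) (hdq : d ^ 2 = q + σ)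
    (hγ : γ = residueSeries N d) (hR : IsRiccatiPair N q σ γ X Z) (hf : IsAdmissible σ f)
    (hs : IsClosedLoopSolution N q σ γ X (gainK N X) (gainL N γ X Z) f z zhat u y)
    {t₀ T : ℝ} (ht₀ : 0 < t₀) (hT : t₀ ≤ T) :
    energy γ X Z (z T) (zhat T) ≤ energy γ X Z (z t₀) (zhat t₀) := by
  have hγ0 : 0 < γ := hγ ▸ residueSeries_pos hd
  have hqN : q < (N : ℝ) ^ 2 := by
    have := sq_sub_sq_pos hd le_rfl
    linarith
  obtain ⟨a, ha, hza⟩ := hs.heat.exists_summable_mode_bound hf hs.continuousOn_input hq hqN ht₀ hT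
  have ha0 : ∀ k, 0 ≤ a k := fun k => (abs_nonneg _).trans (hza k t₀ (left_mem_Icc.2 hT))
  set S := ∑' k, a k with hS
  let tail : ℕ → ℝ := fun j => ∑' k, a (k + j)
  have hS0 : 0 ≤ S := tsum_nonneg ha0
  have haS : ∀ k, a k ≤ S := fun k => ha.le_tsum k fun _ _ => ha0 _
  have htail : Tendsto tail atTop (𝓝 0) := tendsto_sum_nat_add a
  have hc0 : ∀ k, |eigenfun k 0| ≤ 1 := fun k => abs_eigenfun_le k 0
  -- The weak equation differentiates single modes, so the truncations `W j` are differentiated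
  -- instead of the energy, their pointwise limit.
  let W : ℕ → ℝ → ℝ := fun j s => storage γ X Z (modes N (z s)) (zhat s - modes N (z s))
        + ∑ n ∈ Finset.Ico N (j + N), pair (z s) (eigenfun n) ^ 2
  -- the derivative is controlled by the tail of the modes
  have hderiv : ∀ j, ∀ t ∈ Icc t₀ T, ∃ D, HasDerivAt (W j) D t ∧
      D ≤ (γ⁻¹ * (2 * S) + σ * S) * tail j := by
    intro j t ht
    have ht0 : 0 < t := ht₀.trans_le ht.1
    obtain ⟨D, hD, hDle⟩ := exists_deriv_storage_le hσ hd hdq hγ hR hf hs (j + N)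
      (Nat.le_add_left N j) ht0
    refine ⟨D, hD, hDle.trans ?_⟩
    set p : ℕ → ℝ := fun n => pair (z t) (eigenfun n) with hp
    have hpa : ∀ k, |p (k + N)| ≤ a k := fun k => hza k t ht
    have hsum : Summable fun n => |p n| :=
      (summable_nat_add_iff N).1 (Summable.of_nonneg_of_le (fun _ => abs_nonneg _) hpa ha)
    have hy := (hs.output t ht0).hasSum hsum
    -- The output residue `y - Cx` is the full high-mode series at `0`; it differs from its partial
    -- sum by at most `tail j`.
    have hy' : HasSum (fun k => eigenfun (k + N) 0 * p (k + N))
        (y t - ∑ n ∈ Finset.range N, eigenfun n 0 * p n) := (hasSum_nat_add_iff' N).2 hy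
    have hterm : ∀ k, |eigenfun (k + N) 0 * p (k + N)| ≤ a k := by
      intro k
      rw [abs_mul]
      exact (mul_le_of_le_one_left (abs_nonneg _) (hc0 _)).trans (hpa k)
    have hIco : ∀ g : ℕ → ℝ, ∑ n ∈ Finset.Ico N (j + N), g n = ∑ k ∈ Finset.range j, g (k + N) := by
      intro g
      rw [Finset.sum_Ico_eq_sum_range, Nat.add_sub_cancel]
      simp_rw [add_comm N]
    have htaily := (hasSum_nat_add_iff' j).2 hy'
    have h1 : |y t - ∑ n ∈ Finset.range N, eigenfun n 0 * p n| ≤ S := by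
      rw [← Real.norm_eq_abs, ← hy'.tsum_eq]
      exact tsum_of_norm_bounded ha.hasSum hterm
    have h2 : |∑ n ∈ Finset.Ico N (j + N), eigenfun n 0 * p n| ≤ S := by
      rw [hIco]
      refine (Finset.abs_sum_le_sum_abs _ _).trans ?_
      exact (Finset.sum_le_sum fun k _ => hterm k).trans (ha.sum_le_tsum _ fun k _ => ha0 k)
    have h3 : |(y t - ∑ n ∈ Finset.range N, eigenfun n 0 * p n)
        - ∑ n ∈ Finset.Ico N (j + N), eigenfun n 0 * p n| ≤ tail j := by
      rw [hIco, ← Real.norm_eq_abs, ← htaily.tsum_eq]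
      exact tsum_of_norm_bounded ((summable_nat_add_iff j).2 ha).hasSum fun k => hterm (k + j)
    have h4 := mul_le_mul_of_nonneg_left (sq_sub_sq_le_of_abs_le h1 h2 h3) (inv_pos.2 hγ0).le
    have h5 : ‖z t‖ ^ 2 - ∑ n ∈ Finset.range (j + N), p n ^ 2 ≤ S * tail j := by
      have h6 := (hasSum_nat_add_iff' (j + N)).2 (hasSum_pair_sq (z t))
      have h7 : HasSum (fun k => S * a (k + j)) (S * tail j) :=
        ((summable_nat_add_iff j).2 ha).hasSum.mul_left S
      refine hasSum_le (fun k => ?_) h6 h7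
      have h8 := hpa (k + j)
      rw [add_assoc] at h8
      change p (k + (j + N)) ^ 2 ≤ _
      rw [← sq_abs, sq]
      exact mul_le_mul (h8.trans (haS _)) h8 (abs_nonneg _) hS0
    have h9 := mul_le_mul_of_nonneg_left h5 hσ.le
    linarith
  have hWle : ∀ j, W j T ≤ W j t₀ + (γ⁻¹ * (2 * S) + σ * S) * tail j * (T - t₀) := by
    intro j
    have h := (convex_Icc t₀ T).image_sub_le_mul_sub_of_deriv_le (f := W j)
      (C := (γ⁻¹ * (2 * S) + σ * S) * tail j)
      (fun t ht => by
        obtain ⟨D, hD, -⟩ := hderiv j t ht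
        exact hD.continuousAt.continuousWithinAt)
      (fun t ht => by
        obtain ⟨D, hD, -⟩ := hderiv j t (interior_subset ht)
        exact hD.differentiableAt.differentiableWithinAt)
      (fun t ht => by
        obtain ⟨D, hD, hDle⟩ := hderiv j t (interior_subset ht)
        rwa [hD.deriv])
      t₀ (left_mem_Icc.2 hT) T (right_mem_Icc.2 hT) hT
    linarith
  have hWlim : ∀ s, Tendsto (fun j => W j s) atTop (𝓝 (energy γ X Z (z s) (zhat s))) := by
    intro s
    refine tendsto_const_nhds.add ?_
    have h1 := ((hasSum_nat_add_iff' N).2 (hasSum_pair_sq (z s))).tendsto_sum_nat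
    rw [modes_dotProduct_self]
    refine h1.congr fun j => ?_
    rw [Finset.sum_Ico_eq_sum_range, Nat.add_sub_cancel]
    simp_rw [add_comm N]
  have hlim := (hWlim t₀).add ((htail.const_mul (γ⁻¹ * (2 * S) + σ * S)).mul_const (T - t₀))
  rw [mul_zero, zero_mul, add_zero] at hlim
  exact le_of_tendsto_of_tendsto' (hWlim T) hlim hWle

/-- The energy never exceeds its initial value. -/
theorem energy_le_initial (hq : 0 ≤ q) (hσ : 0 < σ) (hd : |d| < N) (hdq : d ^ 2 = q + σ)
    (hγ : γ = residueSeries N d) (hR : IsRiccatiPair N q σ γ X Z) (hf : IsAdmissible σ f)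
    (hs : IsClosedLoopSolution N q σ γ X (gainK N X) (gainL N γ X Z) f z zhat u y)
    {t : ℝ} (ht : 0 ≤ t) :
    energy γ X Z (z t) (zhat t) ≤ energy γ X Z (z 0) (zhat 0) := by
  rcases ht.eq_or_lt with rfl | ht
  · exact le_rfl
  have hpair : ContinuousOn (fun s => (z s, zhat s)) (Ici 0) :=
    hs.heat.continuousOn.prodMk hs.zhat_continuousOn
  have hcont : ContinuousOn (fun s => energy γ X Z (z s) (zhat s)) (Ici 0) := by
    have h := (continuous_energy γ X Z).comp_continuousOn hpair
    rwa [Function.comp_def] at h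
  -- The mode bounds degenerate at time `0`, so the initial time is reached as the limit of positive
  -- times.
  have hlim : Tendsto (fun s => energy γ X Z (z s) (zhat s)) (𝓝[>] 0)
      (𝓝 (energy γ X Z (z 0) (zhat 0))) :=
    (hcont 0 self_mem_Ici).tendsto.mono_left (nhdsWithin_mono 0 Ioi_subset_Ici_self)
  refine ge_of_tendsto hlim ?_
  filter_upwards [Ioc_mem_nhdsGT ht] with s hs'
  exact energy_le_of_pos hq hσ hd hdq hγ hR hf hs hs'.1 hs'.2

end HeatControl

/-! ### Conclusion: comparison of the energy with the norms -/

open HeatControl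
theorem mainTheorem1 (N : ℕ) (q σ : ℝ) (hq : 0 < q) (hσ : 0 < σ)
    (hN : q + σ < (N : ℝ) ^ 2)
    (X Z : Matrix (Fin N) (Fin N) ℝ) (hX : X.PosDef) (hZ : Z.PosDef)
    (hXare : IsStabilizingControlARE N q σ (residueGain N q σ) X)
    (hZare : IsStabilizingFilterARE N q σ (residueGain N q σ) Z)
    (hρ : specRadius (X * Z) < ENNReal.ofReal ((residueGain N q σ ^ 2)⁻¹)) :
    ∃ M : ℝ, 1 ≤ M ∧
      ∀ f : ℝ → L2 → L2, IsAdmissible σ f →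
      ∀ (z : ℝ → L2) (zhat : ℝ → Fin N → ℝ) (u y : ℝ → ℝ),
        IsClosedLoopSolution N q σ (residueGain N q σ) X
          (gainK N X) (gainL N (residueGain N q σ) X Z) f z zhat u y →
        ∀ t : ℝ, 0 ≤ t →
          ‖z t‖ ^ 2 + ‖WithLp.toLp 2 (zhat t - modes N (z t))‖ ^ 2 ≤ M * ‖z 0‖ ^ 2 := by
  have hsqrt : √(q + σ) < N := by
    rw [← Real.sqrt_sq (Nat.cast_nonneg (α := ℝ) N)]
    exact Real.sqrt_lt_sqrt (by positivity) hN
  have hd : |√(q + σ)| < N := by rwa [abs_of_nonneg (Real.sqrt_nonneg _)]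
  have hdq : √(q + σ) ^ 2 = q + σ := Real.sq_sqrt (by positivity)
  have hγ := residueGain_eq_residueSeries hsqrt
  have hγ0 : 0 < residueGain N q σ := hγ ▸ residueSeries_pos hd
  have hR : IsRiccatiPair N q σ (residueGain N q σ) X Z :=
    ⟨hX, hZ, hXare.equation, hZare.equation, posDef_inv_sub_smul hX hZ (by positivity) hρ⟩
  obtain ⟨c, hc, hlow⟩ := exists_le_energy hγ0 hX hR.posDef_coupling
  obtain ⟨c', hc', hup⟩ := exists_energy_zero_le X Z hγ0
  -- The constants `c` and `c'` depend only on `X`, `Z` and `γ`, hence not on `f` or the solution.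
  -- The bound by `c'` needs the observer to start at `0`.
  refine ⟨max 1 (c⁻¹ * c'), le_max_left _ _, fun f hf z zhat u y hs t ht => ?_⟩
  have h1 := energy_le_initial hq.le hσ hd hdq hγ hR hf hs ht
  rw [hs.zhat_zero] at h1
  have h2 := (hlow (z t) (zhat t)).trans (h1.trans (hup (z 0)))
  have h3 : ‖WithLp.toLp 2 (zhat t - modes N (z t))‖ ^ 2 =
      (zhat t - modes N (z t)) ⬝ᵥ (zhat t - modes N (z t)) := by
    rw [EuclideanSpace.real_norm_sq_eq]
    exact Finset.sum_congr rfl fun i _ => sq _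
  rw [h3]
  calc _ = c⁻¹ * (c * (‖z t‖ ^ 2
        + (zhat t - modes N (z t)) ⬝ᵥ (zhat t - modes N (z t)))) := by
        rw [inv_mul_cancel_left₀ hc.ne']
    _ ≤ c⁻¹ * (c' * ‖z 0‖ ^ 2) := by gcongr
    _ = c⁻¹ * c' * ‖z 0‖ ^ 2 := by ring
    _ ≤ _ := by
      gcongr
      exact le_max_right _ _
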